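/- Let $d$ be a natural number and let $\rho(x,\xi)f(t)=e^{-\pi i x\cdot\xi}e^{2\pi i\xi\cdot t}f(t-x)$, $(x,\xi)\in\mathbb R^{2d}$, be the symmetric time-frequency shift on $L^2(\mathbb R^d)$. For $1\le p<\infty$ let $\mathcal S^p$ be the Schatten class of compact operators $T$ on $L^2(\mathbb R^d)$ whose singular values $(s_n(T))$ lie in $\ell^p$, with norm $\|T\|_{\mathcal S^p}=\left(\sum_n s_n(T)^p\right)^{1/p}$. For $T\in\mathcal S^1$ let $\mathcal F_W(T)(z)=\operatorname{tr}(T\rho(z)^*)$, and for $m\in L^\infty(\mathbb R^{2d})$ let \[ \mathfrak T_m(T)=\int_{\mathbb R^{2d}}m(z)\,\mathcal F_W(T)(z)\,\rho(z)\,dz, \] the integral being understood weakly. Let $\mathfrak M_p$ be the set of all $m\in L^\infty(\mathbb R^{2d})$ for which $\mathfrak T_m$ extends from $\mathcal S^1$ to a bounded linear operator $\mathcal S^p\to\mathcal S^p$, and for $m\in\mathfrak M_p$ let $\|m\|_{\mathfrak M_p}$ be the operator norm of this extension. Let $p,q$ be real numbers with $1\le p<q\le 2$. Then \[ \mathfrak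 M_1\subseteq\mathfrak M_p\subseteq\mathfrak M_q\subseteq\mathfrak M_2\cong L^\infty(\mathbb R^{2d}), \] where the last relation means that $\mathfrak M_2=L^\infty(\mathbb R^{2d})$ with $\|m\|_{\mathfrak M_2}=\|m\|_{L^\infty(\mathbb R^{2d})}$ for every $m\in L^\infty(\mathbb R^{2d})$. Moreover \[ \|m\|_{\mathfrak M_2}\le\|m\|_{\mathfrak M_q}\ (m\in\mathfrak M_q),\qquad \|m\|_{\mathfrak M_q}\le\|m\|_{\mathfrak M_p}\ (m\in\mathfrak M_p),\qquad \|m\|_{\mathfrak M_p}\le\|m\|_{\mathfrak M_1}\ (m\in\mathfrak M_1). \] -/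

import Mathlib

open MeasureTheory Filter Topology
open scoped ENNReal NNReal InnerProductSpace

noncomputable section

namespace FourierWigner

/-- The space `ℝ^d` with its Euclidean structure. -/
abbrev Config (d : ℕ) : Type := EuclideanSpace ℝ (Fin d)

/-- Phase space `ℝ^{2d} = ℝ^d × ℝ^d`, with points `z = (x, ξ)` and Lebesgue measure. -/
abbrev Phase (d : ℕ) : Type := Config d × Config d

/-- The complex Hilbert space `L²(ℝ^d)`. -/
abbrev L2 (d : ℕ) : Type := Lp ℂ 2 (volume : Measure (Config d))

/-- The space `L^∞(ℝ^{2d})`. -/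
abbrev LInf (d : ℕ) : Type := Lp ℂ ∞ (volume : Measure (Phase d))

/-- Bounded linear operators on `L²(ℝ^d)`. -/
abbrev Op (d : ℕ) : Type := L2 d →L[ℂ] L2 d

variable {d : ℕ}

/-! ### The symmetric time-frequency shift -/

/-- The function `t ↦ e^{-π i x·ξ} e^{2π i ξ·t} f(t - x)`, where `z = (x, ξ)`. -/
def shiftFun (z : Phase d) (f : Config d → ℂ) (t : Config d) : ℂ :=
  Complex.exp (-(Real.pi * Complex.I * (⟪z.1, z.2⟫_ℝ : ℂ))) *
    Complex.exp (2 * Real.pi * Complex.I * (⟪z.2, t⟫_ℝ : ℂ)) * f (t - z.1)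

theorem norm_shiftFun (z : Phase d) (f : Config d → ℂ) (t : Config d) :
    ‖shiftFun z f t‖ = ‖f (t - z.1)‖ := by
  have h1 : ‖Complex.exp (-(Real.pi * Complex.I * (⟪z.1, z.2⟫_ℝ : ℂ)))‖ = 1 := by
    simp [Complex.norm_exp]
  have h2 : ‖Complex.exp (2 * Real.pi * Complex.I * (⟪z.2, t⟫_ℝ : ℂ))‖ = 1 := by
    simp [Complex.norm_exp]
  rw [shiftFun, norm_mul, norm_mul, h1, h2]
  simp

theorem memLp_shiftFun (z : Phase d) (f : L2 d) :
    MemLp (shiftFun z f) 2 (volume : Measure (Config d)) := by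
  have hf : MemLp (fun t : Config d => f (t - z.1)) 2 volume :=
    (Lp.memLp f).comp_measurePreserving (measurePreserving_sub_right volume z.1)
  refine hf.of_le ?_ (Eventually.of_forall fun t => (norm_shiftFun z f t).le)
  refine AEStronglyMeasurable.mul ?_ hf.1
  exact Continuous.aestronglyMeasurable (by fun_prop)

theorem ae_shift (x : Config d) {P : Config d → Prop} (h : ∀ᵐ t, P t) : ∀ᵐ t, P (t - x) :=
  (measurePreserving_sub_right volume x).quasiMeasurePreserving.ae h

/-- The symmetric time-frequency shift `ρ(x, ξ) f(t) = e^{-π i x·ξ} e^{2π i ξ·t} f(t - x)`, as a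
bounded operator on `L²(ℝ^d)`. -/
def rho (z : Phase d) : Op d :=
  LinearMap.mkContinuous
    { toFun := fun f => (memLp_shiftFun z f).toLp (shiftFun z f)
      map_add' := fun f g => by
        rw [← MemLp.toLp_add, MemLp.toLp_eq_toLp_iff]
        filter_upwards [ae_shift z.1 (Lp.coeFn_add f g)] with t ht
        simp only [shiftFun, ht, Pi.add_apply]
        ring
      map_smul' := fun c f => by
        rw [RingHom.id_apply, ← MemLp.toLp_const_smul, MemLp.toLp_eq_toLp_iff]
        filter_upwards [ae_shift z.1 (Lp.coeFn_smul c f)] with t ht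
        simp only [shiftFun, ht, Pi.smul_apply, smul_eq_mul]
        ring }
    1 (fun f => by
      have h : eLpNorm (shiftFun z f) 2 volume = eLpNorm f 2 volume := by
        rw [← eLpNorm_comp_measurePreserving (Lp.aestronglyMeasurable f)
          (measurePreserving_sub_right volume z.1)]
        exact eLpNorm_congr_norm_ae (Eventually.of_forall fun t => norm_shiftFun z f t)
      rw [one_mul, LinearMap.coe_mk, AddHom.coe_mk, Lp.norm_toLp, h, Lp.norm_def])

theorem coeFn_rho (z : Phase d) (f : L2 d) : rho z f =ᵐ[volume] shiftFun z f :=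
  MemLp.coeFn_toLp (memLp_shiftFun z f)

/-! ### Schatten classes -/

/-- `T = ∑ₙ sₙ eₙ ⊗ ηₙ` is a singular value decomposition of a compact operator `T`, where
`(e ⊗ η) f = ⟨f, η⟩ e`: the `sₙ ≥ 0` tend to `0`, and `(eₙ)`, `(ηₙ)` are orthonormal families.
Zero terms `sₙ = 0` are padding (for operators of finite rank), and the vectors that belong to them
are irrelevant. Each nonzero singular value occurs as often as its multiplicity; the order of the
terms is not prescribed. -/
structure IsSVD (T : Op d) (s : ℕ → ℝ≥0) (e η : ℕ → L2 d) : Prop where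
  tendsto_zero : Tendsto s atTop (𝓝 0)
  orthonormal_left : Orthonormal ℂ (fun n : {n : ℕ // s n ≠ 0} => e n)
  orthonormal_right : Orthonormal ℂ (fun n : {n : ℕ // s n ≠ 0} => η n)
  hasSum : ∀ f : L2 d, HasSum (fun n => ((s n : ℝ) : ℂ) • (⟪η n, f⟫_ℂ • e n)) (T f)

/-- The Schatten norm `‖T‖_{𝓢^p} = (∑ₙ sₙ(T)^p)^{1/p}`, `1 ≤ p < ∞`, with values in `[0, ∞]`.
All singular value decompositions of `T` give the same value, so that the infimum only selects it;
it is `∞` if `T` has none, that is, if `T` is not compact. -/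
def schattenNorm (p : ℝ) (T : Op d) : ℝ≥0∞ :=
  ⨅ (s : ℕ → ℝ≥0) (e : ℕ → L2 d) (η : ℕ → L2 d) (_ : IsSVD T s e η),
    (∑' n, (s n : ℝ≥0∞) ^ p) ^ (1 / p)

/-- The Schatten class `𝓢^p`, `1 ≤ p < ∞`. -/
def schattenClass (d : ℕ) (p : ℝ) : Set (Op d) := {T | schattenNorm p T < ∞}

/-! ### The Fourier-Wigner transform and its multipliers -/

/-- The index set of an orthonormal basis of `L²(ℝ^d)`. -/
def basisIndex (d : ℕ) : Set (L2 d) := (exists_hilbertBasis ℂ (L2 d)).choose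

/-- An orthonormal basis of `L²(ℝ^d)`. -/
def basis (d : ℕ) : HilbertBasis (basisIndex d) ℂ (L2 d) :=
  (exists_hilbertBasis ℂ (L2 d)).choose_spec.choose

/-- The trace `tr A = ∑ᵢ ⟨A bᵢ, bᵢ⟩` of a trace class operator `A`, for an orthonormal basis `(bᵢ)`;
it does not depend on the basis. -/
def trace (A : Op d) : ℂ := ∑' i, ⟪basis d i, A (basis d i)⟫_ℂ

/-- The Fourier-Wigner transform `𝓕_W(T)(z) = tr (T ρ(z)^*)` of a trace class operator `T`. -/
def fourierWigner (T : Op d) (z : Phase d) : ℂ :=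
  trace (T ∘L ContinuousLinearMap.adjoint (rho z))

/-- `A = 𝔗_m(T)`, that is, `A = ∫ m(z) 𝓕_W(T)(z) ρ(z) dz` as a weak integral over `ℝ^{2d}`, for a
trace class operator `T`. -/
def IsMultiplierImage (m : LInf d) (T A : Op d) : Prop :=
  ∀ f g : L2 d,
    Integrable (fun z : Phase d => m z * fourierWigner T z * ⟪g, rho z f⟫_ℂ) volume ∧
      ⟪g, A f⟫_ℂ = ∫ z : Phase d, m z * fourierWigner T z * ⟪g, rho z f⟫_ℂ

/-- `Φ`, considered on `𝓢^p`, is a bounded linear operator from `𝓢^p` to `𝓢^q` of norm at most `C`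
that extends the Fourier-Wigner multiplier `𝔗_m`, which is given on `𝓢^1`.
(`p ≥ 1`, so that `𝓢^1 ⊆ 𝓢^p`. By `bound`, `Φ` maps `𝓢^p` into `𝓢^q`.) -/
structure IsBoundedExtension (p q : ℝ) (m : LInf d) (Φ : Op d → Op d) (C : ℝ≥0) : Prop where
  map_add : ∀ S ∈ schattenClass d p, ∀ T ∈ schattenClass d p, Φ (S + T) = Φ S + Φ T
  map_smul : ∀ (c : ℂ), ∀ T ∈ schattenClass d p, Φ (c • T) = c • Φ T
  bound : ∀ T ∈ schattenClass d p, schattenNorm q (Φ T) ≤ C * schattenNorm p T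
  extends_multiplier : ∀ T ∈ schattenClass d 1, IsMultiplierImage m T (Φ T)

/-- `𝔐_{p,q}`: all `m ∈ L^∞(ℝ^{2d})` for which `𝔗_m` extends to a bounded linear operator from
`𝓢^p` to `𝓢^q`. -/
def multipliers₂ (d : ℕ) (p q : ℝ) : Set (LInf d) :=
  {m | ∃ (Φ : Op d → Op d) (C : ℝ≥0), IsBoundedExtension p q m Φ C}

/-- `‖m‖_{𝔐_{p,q}}`, the operator norm of the extension of `𝔗_m` from `𝓢^p` to `𝓢^q`, for
`m ∈ 𝔐_{p,q}`. -/
def multiplierNorm₂ (p q : ℝ) (m : LInf d) : ℝ≥0 :=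
  sInf {C : ℝ≥0 | ∃ Φ : Op d → Op d, IsBoundedExtension p q m Φ C}

/-- `𝔐_p = 𝔐_{p,p}`. -/
def multipliers (d : ℕ) (p : ℝ) : Set (LInf d) := multipliers₂ d p p

/-- `‖m‖_{𝔐_p} = ‖m‖_{𝔐_{p,p}}`. -/
def multiplierNorm (p : ℝ) (m : LInf d) : ℝ≥0 := multiplierNorm₂ p p m

end FourierWigner

end

open MeasureTheory Filter Topology
open scoped ENNReal NNReal InnerProductSpace

noncomputable section

namespace FourierWigner

variable {d : ℕ}

/-! ### Fourier analysis -/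

/-! For a rank one operator `e ⊗ η` the Fourier-Wigner transform is `z ↦ ⟨e, ρ(z) η⟩` (`amb η e`).
Moyal's identity `inner_amb_amb` says that this assignment preserves Hilbert-Schmidt inner products,
and the rank one transforms are complete in `L²` of phase space. Hence `weyl`, `u ↦ ∫ u(z) ρ(z) dz`,
identifies `L²(ℝ^{2d})` isometrically with `𝓢²`, and `𝔗_m` becomes multiplication of the symbol `u`
by `m` (`isMultiplierImage_weyl_iff`). A multiplication operator on `L²` has norm `‖m‖_∞`, which
settles `𝔐_2`.

For `p < q ≤ 2` one interpolates between `𝓢^p` and its dual. In the trace pairing the transpose of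
`𝔗_m` has the reflected multiplier `m(-z)`, and conjugation by the parity operator reflects it back.
So a bound `C` on `𝓢^p` gives the same bound on the dual side (`inner_mulL_parity`). For finite rank
`T_w = ∑ sᵢ^w eᵢ ⊗ ηᵢ` and `S_w = ∑ tₖ^(1-w) fₖ ⊗ gₖ` with `∑ sᵢ, ∑ tₖ ≤ 1`, the entire function
`tr(𝔗_m(T_w) S_w)` is at most `C` on `Re w = 1/p` by Hölder, and on `Re w = 1 - 1/p` by parity. The
three lines theorem gives `C` at `w = 1/q`, which lies in this strip because `1/2 ≤ 1/q < 1/p`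
(`norm_interpForm_le`). Duality turns this into the bound on `𝓢^q` with the same constant
(`isBoundedExtension_of_lt`), so both the inclusions and the norm inequalities follow. -/

open FourierTransform SchwartzMap in
theorem fourier_toLp_ae_eq {E : Type*} [NormedAddCommGroup E] [InnerProductSpace ℝ E]
    [FiniteDimensional ℝ E] [MeasurableSpace E] [BorelSpace E] {f : E → ℂ}
    (h1 : Integrable f) (h2 : MemLp f 2 volume) :
    (𝓕 (h2.toLp f) : Lp ℂ 2 (volume : Measure E)) =ᵐ[volume] 𝓕 f := by
  have hc : Continuous (𝓕 f) :=
    VectorFourier.fourierIntegral_continuous Real.continuous_fourierChar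
      (by exact continuous_inner) h1
  -- The `L²` transform is tested against smooth compactly supported `g` as a tempered distribution.
  -- Moving the transform from `f` to the test function gives the integral formula.
  refine ae_eq_of_integral_contDiff_smul_eq ?_ hc.locallyIntegrable ?_
  · exact (Lp.memLp _).locallyIntegrable (by norm_num)
  · intro g hg hgc
    have := Lp.fourier_toTemperedDistribution_eq (h2.toLp f)
    let φ : 𝓢(E, ℂ) := (hgc.comp_left (g := ((↑) : ℝ → ℂ)) (by simp)).toSchwartzMap
      (Complex.ofRealCLM.contDiff.comp hg)
    have h := congrArg (fun T => T φ) this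
    simp only [TemperedDistribution.fourier_apply, Lp.toTemperedDistribution_apply] at h
    have hφ (x : E) : φ x = (g x : ℂ) := rfl
    simp only [hφ, smul_eq_mul] at h
    simp only [Complex.real_smul]
    rw [← h]
    have h3 : ∫ x, (𝓕 φ) x * (h2.toLp f) x = ∫ x, (𝓕 (φ : E → ℂ)) x * f x :=
      integral_congr_ae (by
        filter_upwards [h2.coeFn_toLp] with x hx
        rw [hx, fourier_coe])
    rw [h3]
    exact VectorFourier.integral_fourierIntegral_smul_eq_flip (L := innerₗ E) (μ := volume)
      (ν := volume) Real.continuous_fourierChar continuous_inner φ.integrable h1 |>.trans (by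
        rw [flip_innerₗ]; rfl)

open FourierTransform in
theorem eLpNorm_fourier_eq {E : Type*} [NormedAddCommGroup E] [InnerProductSpace ℝ E]
    [FiniteDimensional ℝ E] [MeasurableSpace E] [BorelSpace E] {f : E → ℂ}
    (h1 : Integrable f) (h2 : MemLp f 2 volume) :
    eLpNorm (𝓕 f) 2 volume = eLpNorm f 2 volume := by
  rw [← eLpNorm_congr_ae (fourier_toLp_ae_eq h1 h2), ← eLpNorm_congr_ae h2.coeFn_toLp,
    ← ENNReal.toReal_eq_toReal_iff' (Lp.memLp _).2.ne (Lp.memLp _).2.ne, ← Lp.norm_def,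
    ← Lp.norm_def, Lp.norm_fourier_eq]

/-! ### Symplectic characters and uniqueness of the Fourier transform. -/

/-- The standard symplectic form on phase space. -/
def symplectic (z w : Phase d) : ℝ := ⟪w.1, z.2⟫_ℝ - ⟪z.1, w.2⟫_ℝ

/-- The symplectic form as a bilinear map. -/
def symplecticₗ (d : ℕ) : Phase d →ₗ[ℝ] Phase d →ₗ[ℝ] ℝ :=
  LinearMap.mk₂ ℝ symplectic
    (fun a b c => by simp only [symplectic, Prod.fst_add, Prod.snd_add, inner_add_left,
      inner_add_right]; ring)
    (fun a b c => by simp only [symplectic, Prod.smul_fst, Prod.smul_snd, inner_smul_left,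
      inner_smul_right, smul_eq_mul, conj_trivial]; ring)
    (fun a b c => by simp only [symplectic, Prod.fst_add, Prod.snd_add, inner_add_left,
      inner_add_right]; ring)
    (fun a b c => by simp only [symplectic, Prod.smul_fst, Prod.smul_snd, inner_smul_left,
      inner_smul_right, smul_eq_mul, conj_trivial]; ring)

theorem continuous_symplectic : Continuous fun p : Phase d × Phase d => symplectic p.1 p.2 := by
  unfold symplectic
  fun_prop

/-- The character `z ↦ e^{2π i [z, w]}` of phase space. -/
def symplecticChar (w z : Phase d) : ℂ := Complex.exp (2 * Real.pi * Complex.I * symplectic z w)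

theorem continuous_symplecticChar (w : Phase d) : Continuous (symplecticChar w) := by
  have := (continuous_symplectic (d := d)).comp (Continuous.prodMk_left w)
  unfold symplecticChar
  exact Complex.continuous_exp.comp (continuous_const.mul (Complex.continuous_ofReal.comp this))

theorem norm_symplecticChar (w z : Phase d) : ‖symplecticChar w z‖ = 1 := by
  simp [symplecticChar, Complex.norm_exp]

theorem measure_ext_of_integral_symplecticChar {μ ν : Measure (Phase d)} [IsFiniteMeasure μ]
    [IsFiniteMeasure ν]
    (h : ∀ w, ∫ z, symplecticChar w z ∂μ = ∫ z, symplecticChar w z ∂ν) : μ = ν := by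
  refine ext_of_integral_char_eq (e := Real.fourierChar) (L := symplecticₗ d)
    Real.continuous_fourierChar ?_ ?_ continuous_symplectic ?_
  · intro h1
    have h2 := congrArg (fun e : AddChar ℝ Circle => (e (1 / 2) : ℂ)) h1
    simp only [Real.fourierChar_apply, AddChar.one_apply, Circle.coe_one] at h2
    rw [show ((2 * Real.pi * (1 / 2) : ℝ) : ℂ) * Complex.I = Real.pi * Complex.I by
      push_cast; ring, Complex.exp_pi_mul_I] at h2
    norm_num at h2
  · intro v hv h1
    apply hv
    -- Nondegeneracy: the symplectic form of `v` and `(v.2, -v.1)` is `‖v.1‖² + ‖v.2‖²`.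
    have h2 := LinearMap.congr_fun h1 (v.2, -v.1)
    simp only [symplecticₗ, LinearMap.mk₂_apply, symplectic, inner_neg_right, sub_neg_eq_add,
      LinearMap.zero_apply] at h2
    have h3 := real_inner_self_nonneg (x := v.1)
    have h4 := real_inner_self_nonneg (x := v.2)
    exact Prod.ext (inner_self_eq_zero (𝕜 := ℝ) |>.mp (by linarith))
      (inner_self_eq_zero (𝕜 := ℝ) |>.mp (by linarith))
  · intro w
    refine Eq.trans ?_ ((h w).trans ?_) <;>
    · refine integral_congr_ae (Eventually.of_forall fun z => ?_)
      simp only [BoundedContinuousFunction.char_apply, Real.fourierChar_apply, symplecticChar,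
        symplecticₗ, LinearMap.mk₂_apply]
      congr 1
      push_cast
      ring

/-- The positive and negative parts of `u` are densities of two finite measures with equal
transforms, so the measures coincide. Since the two parts are never both nonzero, `u` vanishes. -/
theorem ae_eq_zero_of_integral_symplecticChar_real {u : Phase d → ℝ} (hu : Integrable u)
    (h : ∀ w, ∫ z, symplecticChar w z * (u z : ℂ) = 0) : u =ᵐ[volume] 0 := by
  have hm : AEMeasurable u := hu.1.aemeasurable
  have hfin : ∀ v : Phase d → ℝ, Integrable v →
      IsFiniteMeasure (volume.withDensity fun z => ENNReal.ofReal (v z)) := fun v hv =>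
    isFiniteMeasure_withDensity_ofReal hv.2
  have := hfin u hu
  have hn : Integrable fun z => -u z := hu.neg
  have := hfin _ hn
  have hint : ∀ v : Phase d → ℝ, Integrable v → ∀ w,
      ∫ z, symplecticChar w z ∂(volume.withDensity fun z => ENNReal.ofReal (v z)) =
        ∫ z, symplecticChar w z * ((max (v z) 0 : ℝ) : ℂ) := by
    intro v hv w
    rw [integral_withDensity_eq_integral_toReal_smul₀ hv.1.aemeasurable.ennreal_ofReal
      (Eventually.of_forall fun _ => ENNReal.ofReal_lt_top)]
    refine integral_congr_ae (Eventually.of_forall fun z => ?_)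
    simp only [ENNReal.toReal_ofReal', Complex.real_smul]
    ring
  have hI : ∀ v : Phase d → ℝ, Integrable v → ∀ w,
      Integrable fun z => symplecticChar w z * ((max (v z) 0 : ℝ) : ℂ) := by
    intro v hv w
    exact hv.pos_part.ofReal.bdd_mul (c := 1) (continuous_symplecticChar w).aestronglyMeasurable
      (Eventually.of_forall fun z => (norm_symplecticChar w z).le)
  have key := measure_ext_of_integral_symplecticChar
    (μ := volume.withDensity fun z => ENNReal.ofReal (u z))
    (ν := volume.withDensity fun z => ENNReal.ofReal (-u z)) (fun w => by
      rw [hint u hu, hint _ hn, ← sub_eq_zero, ← integral_sub (hI u hu w) (hI _ hn w),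
        ← h w]
      refine integral_congr_ae (Eventually.of_forall fun z => ?_)
      simp only [← mul_sub, ← Complex.ofReal_sub]
      congr 2
      rcases le_total (u z) 0 with h0 | h0
      · rw [max_eq_right h0, max_eq_left (by linarith)]; ring
      · rw [max_eq_left h0, max_eq_right (by linarith)]; ring)
  rw [withDensity_eq_iff hm.ennreal_ofReal hn.1.aemeasurable.ennreal_ofReal
    (hu.lintegral_lt_top).ne] at key
  filter_upwards [key] with z hz
  rcases le_total (u z) 0 with h0 | h0
  · rw [ENNReal.ofReal_of_nonpos h0, eq_comm, ENNReal.ofReal_eq_zero] at hz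
    exact le_antisymm h0 (by simpa using hz)
  · rw [ENNReal.ofReal_of_nonpos (show -u z ≤ 0 by linarith), ENNReal.ofReal_eq_zero] at hz
    exact le_antisymm hz h0

theorem symplecticChar_neg (w z : Phase d) :
    symplecticChar (-w) z = (starRingEnd ℂ) (symplecticChar w z) := by
  simp only [symplecticChar, ← Complex.exp_conj, map_mul, Complex.conj_I, Complex.conj_ofReal,
    map_ofNat]
  congr 1
  simp only [symplectic, Prod.fst_neg, Prod.snd_neg, inner_neg_left, inner_neg_right]
  push_cast
  ring

/-- Conjugating the hypothesis at `-w` gives the same hypothesis for the conjugate of `u`, hence for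
its real and imaginary parts. -/
theorem ae_eq_zero_of_integral_symplecticChar {u : Phase d → ℂ} (hu : Integrable u)
    (h : ∀ w, ∫ z, symplecticChar w z * u z = 0) : u =ᵐ[volume] 0 := by
  have hI : ∀ v : Phase d → ℂ, Integrable v → ∀ w, Integrable fun z => symplecticChar w z * v z :=
    fun v hv w => hv.bdd_mul (c := 1) (continuous_symplecticChar w).aestronglyMeasurable
      (Eventually.of_forall fun z => (norm_symplecticChar w z).le)
  have hcu : Integrable fun z => (starRingEnd ℂ) (u z) :=
    (LinearIsometryEquiv.integrable_comp_iff Complex.conjLIE).2 hu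
  have hc : ∀ w, ∫ z, symplecticChar w z * (starRingEnd ℂ) (u z) = 0 := by
    intro w
    have h1 := congrArg (starRingEnd ℂ) (h (-w))
    rw [← integral_conj, map_zero] at h1
    rw [← h1]
    refine integral_congr_ae (Eventually.of_forall fun z => ?_)
    simp [symplecticChar_neg]
  have hre := ae_eq_zero_of_integral_symplecticChar_real hu.re (fun w => by
    have h1 := integral_add (hI _ hu w) (hI _ hcu w)
    rw [h w, hc w, add_zero] at h1
    have h2 : ∫ z, symplecticChar w z * ((RCLike.re (u z) : ℝ) : ℂ) =
        ∫ z, (2⁻¹ : ℂ) * (symplecticChar w z * u z + symplecticChar w z * (starRingEnd ℂ) (u z)) := by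
      refine integral_congr_ae (Eventually.of_forall fun z => ?_)
      simp only [← mul_add, Complex.add_conj, RCLike.re_eq_complex_re]
      push_cast
      ring
    rw [h2, integral_const_mul, h1, mul_zero])
  have him := ae_eq_zero_of_integral_symplecticChar_real hu.im (fun w => by
    have h1 := integral_sub (hI _ hu w) (hI _ hcu w)
    rw [h w, hc w, sub_zero] at h1
    have h2 : ∫ z, symplecticChar w z * ((RCLike.im (u z) : ℝ) : ℂ) =
        ∫ z, (2 * Complex.I)⁻¹ *
          (symplecticChar w z * u z - symplecticChar w z * (starRingEnd ℂ) (u z)) := by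
      refine integral_congr_ae (Eventually.of_forall fun z => ?_)
      simp only [← mul_sub, Complex.sub_conj, RCLike.im_eq_complex_im]
      push_cast
      field_simp
    rw [h2, integral_const_mul, h1, mul_zero])
  filter_upwards [hre, him] with z h1 h2
  exact Complex.ext h1 h2

/-! ### The Fourier-Wigner transform of rank one operators -/

theorem norm_rho_apply (z : Phase d) (f : L2 d) : ‖rho z f‖ = ‖f‖ := by
  have h : eLpNorm (rho z f) 2 volume = eLpNorm f 2 volume := by
    rw [eLpNorm_congr_ae (coeFn_rho z f), ← eLpNorm_comp_measurePreserving
      (Lp.aestronglyMeasurable f) (measurePreserving_sub_right volume z.1)]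
    exact eLpNorm_congr_norm_ae (Eventually.of_forall fun t => norm_shiftFun z f t)
  rw [Lp.norm_def, h, Lp.norm_def]

/-- The shift `ρ(z)` as a linear isometry. -/
def rhoIsometry (z : Phase d) : L2 d →ₗᵢ[ℂ] L2 d := ⟨(rho z).toLinearMap, norm_rho_apply z⟩

theorem inner_rho_rho (z : Phase d) (f g : L2 d) : ⟪rho z f, rho z g⟫_ℂ = ⟪f, g⟫_ℂ :=
  (rhoIsometry z).inner_map_map f g

theorem inner_rho_eq_integral (z : Phase d) (f g : L2 d) :
    ⟪rho z f, g⟫_ℂ = ∫ t, g t * (starRingEnd ℂ) (shiftFun z f t) := by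
  rw [L2.inner_def]
  refine integral_congr_ae ?_
  filter_upwards [coeFn_rho z f] with t ht
  rw [ht, RCLike.inner_apply]

theorem stronglyMeasurable_inner_rho (f g : L2 d) :
    StronglyMeasurable fun z : Phase d => ⟪rho z f, g⟫_ℂ := by
  simp_rw [inner_rho_eq_integral]
  refine StronglyMeasurable.integral_prod_right (f := fun z t =>
    g t * (starRingEnd ℂ) (shiftFun z f t)) ?_
  have h1 : StronglyMeasurable fun p : Phase d × Config d => g p.2 :=
    (Lp.stronglyMeasurable g).comp_measurable measurable_snd
  have h2 : StronglyMeasurable fun p : Phase d × Config d => f (p.2 - p.1.1) :=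
    (Lp.stronglyMeasurable f).comp_measurable (by fun_prop)
  refine h1.mul (Complex.continuous_conj.comp_stronglyMeasurable ?_)
  refine StronglyMeasurable.mul (Continuous.stronglyMeasurable (by fun_prop)) h2

theorem sq_eLpNorm_two {α : Type*} [MeasurableSpace α] {μ : Measure α} (f : α → ℂ) :
    eLpNorm f 2 μ ^ 2 = ∫⁻ x, ‖f x‖ₑ ^ 2 ∂μ := by
  have := eLpNorm_nnreal_pow_eq_lintegral (μ := μ) (f := f) (p := 2) (by norm_num)
  simpa using this

-- For fixed `x` the coefficient is, up to a unimodular factor, a Fourier transform in `ξ`. This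
-- reduces its `L²` norm to Plancherel.
open FourierTransform in
theorem enorm_inner_rho_eq (x ξ : Config d) (f g : L2 d) :
    ‖⟪rho (x, ξ) f, g⟫_ℂ‖ₑ = ‖𝓕 (fun t => g t * (starRingEnd ℂ) (f (t - x))) ξ‖ₑ := by
  rw [inner_rho_eq_integral, Real.fourier_eq']
  have : ∀ t, g t * (starRingEnd ℂ) (shiftFun (x, ξ) f t) =
      Complex.exp (Real.pi * Complex.I * (⟪x, ξ⟫_ℝ : ℂ)) *
        (Complex.exp (↑(-2 * Real.pi * ⟪t, ξ⟫_ℝ) * Complex.I) •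
          (g t * (starRingEnd ℂ) (f (t - x)))) := by
    intro t
    simp only [shiftFun, map_mul, ← Complex.exp_conj, map_neg, Complex.conj_I,
      Complex.conj_ofReal, map_ofNat, smul_eq_mul, real_inner_comm t ξ]
    rw [show -((Real.pi : ℂ) * -Complex.I * (⟪x, ξ⟫_ℝ : ℂ)) =
      Real.pi * Complex.I * (⟪x, ξ⟫_ℝ : ℂ) by ring, show (2 * (Real.pi : ℂ) * -Complex.I *
        (⟪t, ξ⟫_ℝ : ℂ)) = ↑(-2 * Real.pi * ⟪t, ξ⟫_ℝ) * Complex.I by push_cast; ring]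
    ring
  simp_rw [this]
  rw [integral_const_mul, enorm_mul]
  have h1 : ‖Complex.exp (Real.pi * Complex.I * (⟪x, ξ⟫_ℝ : ℂ))‖ₑ = 1 := by
    rw [← ofReal_norm]
    simp [Complex.norm_exp]
  rw [h1, one_mul]

theorem memLp_shift (x : Config d) (f : L2 d) :
    MemLp (fun t => (starRingEnd ℂ) (f (t - x))) 2 volume :=
  MemLp.star ((Lp.memLp f).comp_measurePreserving (measurePreserving_sub_right volume x))

theorem integrable_mul_conj_shift (x : Config d) (f g : L2 d) :
    Integrable fun t => g t * (starRingEnd ℂ) (f (t - x)) :=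
  (Lp.memLp g).integrable_mul (memLp_shift x f)

theorem measurable_mul_conj_shift (f g : L2 d) :
    Measurable fun p : Config d × Config d =>
      ‖g p.2 * (starRingEnd ℂ) (f (p.2 - p.1))‖ₑ ^ 2 := by
  have hf := (Lp.stronglyMeasurable f).measurable
  have hg := (Lp.stronglyMeasurable g).measurable
  have h1 : Measurable fun p : Config d × Config d => f (p.2 - p.1) := hf.comp (by fun_prop)
  exact (((hg.comp measurable_snd).mul
    (Complex.continuous_conj.measurable.comp h1)).enorm).pow_const 2

theorem lintegral_lintegral_shift (f g : L2 d) :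
    ∫⁻ x : Config d, ∫⁻ t, ‖g t * (starRingEnd ℂ) (f (t - x))‖ₑ ^ 2 =
      (‖f‖ₑ * ‖g‖ₑ) ^ 2 := by
  have hf := (Lp.stronglyMeasurable f).measurable
  have hg := (Lp.stronglyMeasurable g).measurable
  rw [lintegral_lintegral_swap (measurable_mul_conj_shift f g).aemeasurable]
  have : ∀ t : Config d, ∫⁻ x, ‖g t * (starRingEnd ℂ) (f (t - x))‖ₑ ^ 2 =
      ‖g t‖ₑ ^ 2 * eLpNorm f 2 volume ^ 2 := by
    intro t
    rw [sq_eLpNorm_two, ← lintegral_sub_left_eq_self (fun x => ‖f x‖ₑ ^ 2) t,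
      ← lintegral_const_mul _ (by fun_prop)]
    refine lintegral_congr fun x => ?_
    rw [enorm_mul, mul_pow]
    congr 2
    rw [← ofReal_norm, RCLike.norm_conj, ofReal_norm]
  simp_rw [this]
  rw [lintegral_mul_const _ (by fun_prop), ← sq_eLpNorm_two, mul_pow, mul_comm,
    Lp.enorm_def, Lp.enorm_def]

/-- Plancherel in `ξ` for fixed `x`, then Tonelli and translation invariance in `x`. -/
theorem eLpNorm_inner_rho (f g : L2 d) :
    eLpNorm (fun z : Phase d => ⟪rho z f, g⟫_ℂ) 2 volume = ‖f‖ₑ * ‖g‖ₑ := by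
  have hsq : eLpNorm (fun z : Phase d => ⟪rho z f, g⟫_ℂ) 2 volume ^ 2 = (‖f‖ₑ * ‖g‖ₑ) ^ 2 := by
    have hm := (stronglyMeasurable_inner_rho f g).measurable
    rw [sq_eLpNorm_two, Measure.volume_eq_prod, lintegral_prod _ (hm.enorm.pow_const 2).aemeasurable,
      ← lintegral_lintegral_shift f g]
    -- The product `g(t) · conj f(t - x)` is integrable for every `x`, but its square integrability
    -- is obtained only for almost every `x`; that suffices.
    have hfin : ∀ᵐ x : Config d, ∫⁻ t, ‖g t * (starRingEnd ℂ) (f (t - x))‖ₑ ^ 2 < ∞ := by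
      refine ae_lt_top (measurable_mul_conj_shift f g).lintegral_prod_right ?_
      rw [lintegral_lintegral_shift]
      finiteness
    refine lintegral_congr_ae ?_
    filter_upwards [hfin] with x hx
    simp_rw [enorm_inner_rho_eq]
    have h1 := integrable_mul_conj_shift x f g
    have h2 : MemLp (fun t => g t * (starRingEnd ℂ) (f (t - x))) 2 volume := by
      refine ⟨h1.1, ?_⟩
      rw [← sq_eLpNorm_two] at hx
      by_contra hc
      rw [not_lt, top_le_iff] at hc
      rw [hc] at hx
      simp at hx
    rw [← sq_eLpNorm_two, ← sq_eLpNorm_two, eLpNorm_fourier_eq h1 h2]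
  exact (ENNReal.pow_right_strictMono two_ne_zero).injective hsq

theorem memLp_inner_rho (f g : L2 d) :
    MemLp (fun z : Phase d => ⟪rho z f, g⟫_ℂ) 2 volume :=
  ⟨(stronglyMeasurable_inner_rho f g).aestronglyMeasurable, by
    rw [eLpNorm_inner_rho]; finiteness⟩

/-- Square integrable functions on phase space. -/
abbrev L2Phase (d : ℕ) : Type := Lp ℂ 2 (volume : Measure (Phase d))

/-- The function `z ↦ ⟨g, ρ(z) f⟩`, the Fourier-Wigner transform of `g ⊗ f`, as a bounded linear
function of `g`. -/
def amb (f : L2 d) : L2 d →L[ℂ] L2Phase d :=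
  LinearMap.mkContinuous
    { toFun := fun g => (memLp_inner_rho f g).toLp (fun z => ⟪rho z f, g⟫_ℂ)
      map_add' := fun g g' => by
        rw [← MemLp.toLp_add, MemLp.toLp_eq_toLp_iff]
        exact Eventually.of_forall fun z => by simp [inner_add_right]
      map_smul' := fun c g => by
        rw [RingHom.id_apply, ← MemLp.toLp_const_smul, MemLp.toLp_eq_toLp_iff]
        exact Eventually.of_forall fun z => by simp [inner_smul_right] }
    ‖f‖ (fun g => by
      rw [LinearMap.coe_mk, AddHom.coe_mk, Lp.norm_toLp, eLpNorm_inner_rho]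
      simp)

theorem coeFn_amb (f g : L2 d) : amb f g =ᵐ[volume] fun z => ⟪rho z f, g⟫_ℂ :=
  MemLp.coeFn_toLp (memLp_inner_rho f g)

theorem norm_amb (f g : L2 d) : ‖amb f g‖ = ‖f‖ * ‖g‖ := by
  rw [Lp.norm_def, eLpNorm_congr_ae (coeFn_amb f g), eLpNorm_inner_rho]
  simp

theorem amb_add (f f' g : L2 d) : amb (f + f') g = amb f g + amb f' g := by
  apply Lp.ext
  filter_upwards [coeFn_amb (f + f') g, coeFn_amb f g, coeFn_amb f' g,
    Lp.coeFn_add (amb f g) (amb f' g)] with z h1 h2 h3 h4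
  rw [h1, h4, Pi.add_apply, h2, h3, map_add, inner_add_left]

theorem amb_smul (c : ℂ) (f g : L2 d) : amb (c • f) g = (starRingEnd ℂ) c • amb f g := by
  apply Lp.ext
  filter_upwards [coeFn_amb (c • f) g, coeFn_amb f g,
    Lp.coeFn_smul ((starRingEnd ℂ) c) (amb f g)] with z h1 h2 h4
  rw [h1, h4, Pi.smul_apply, h2, map_smul, inner_smul_left, smul_eq_mul]

/-- Polarization in the second argument: `norm_amb` gives the quadratic form of `(amb f)^* (amb f)`,
and a complex operator is determined by its quadratic form. -/
theorem inner_amb_amb_left (f g₁ g₂ : L2 d) :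
    ⟪amb f g₁, amb f g₂⟫_ℂ = ⟪f, f⟫_ℂ * ⟪g₁, g₂⟫_ℂ := by
  have h : (ContinuousLinearMap.adjoint (amb f) ∘L amb f) = ⟪f, f⟫_ℂ • (1 : Op d) := by
    rw [← sub_eq_zero, ← ContinuousLinearMap.coe_inj, ContinuousLinearMap.toLinearMap_zero,
      ← inner_map_self_eq_zero]
    intro g
    simp only [ContinuousLinearMap.coe_coe, sub_apply, inner_sub_left,
      ContinuousLinearMap.comp_apply, smul_apply,
      one_apply_eq_self, ContinuousLinearMap.adjoint_inner_left,
      inner_smul_left, inner_conj_symm]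
    rw [inner_self_eq_norm_sq_to_K, norm_amb, inner_self_eq_norm_sq_to_K,
      inner_self_eq_norm_sq_to_K]
    push_cast
    ring
  rw [← ContinuousLinearMap.adjoint_inner_right, ← ContinuousLinearMap.comp_apply, h,
    smul_apply, one_apply_eq_self, inner_smul_right]

/-- Moyal's identity. -/
theorem inner_amb_amb (f₁ g₁ f₂ g₂ : L2 d) :
    ⟪amb f₁ g₁, amb f₂ g₂⟫_ℂ = ⟪f₂, f₁⟫_ℂ * ⟪g₁, g₂⟫_ℂ := by
  -- Polarization in the first argument; the factor `I` in `h2` separates the two cross terms.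
  have h1 := inner_amb_amb_left (f₁ + f₂) g₁ g₂
  have h2 := inner_amb_amb_left (f₁ + Complex.I • f₂) g₁ g₂
  have h3 := inner_amb_amb_left f₁ g₁ g₂
  have h4 := inner_amb_amb_left f₂ g₁ g₂
  simp only [amb_add, amb_smul, inner_add_left, inner_add_right, inner_smul_left,
    inner_smul_right, Complex.conj_I, map_neg, Complex.conj_I] at h1 h2 h3 h4
  have hI := Complex.I_sq
  linear_combination (1 / 2 : ℂ) * (h1 - h3 - h4) + (Complex.I / 2) * (h2 - h3 - h4) +
    hI * ((⟪amb f₁ g₁, amb f₂ g₂⟫_ℂ - ⟪f₂, f₁⟫_ℂ * ⟪g₁, g₂⟫_ℂ + ⟪f₁, f₂⟫_ℂ * ⟪g₁, g₂⟫_ℂ -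
      ⟪amb f₂ g₁, amb f₁ g₂⟫_ℂ + Complex.I * (⟪amb f₂ g₁, amb f₂ g₂⟫_ℂ -
      ⟪f₂, f₂⟫_ℂ * ⟪g₁, g₂⟫_ℂ)) / 2)

/-! ### Completeness of the Fourier-Wigner transforms of rank one operators -/

theorem shiftFun_shiftFun (z w : Phase d) (f : Config d → ℂ) (t : Config d) :
    shiftFun z (shiftFun w f) t = symplecticChar w z * shiftFun w (shiftFun z f) t := by
  simp only [shiftFun, symplecticChar, symplectic]
  rw [show t - w.1 - z.1 = t - z.1 - w.1 by abel]
  simp only [← mul_assoc, ← Complex.exp_add]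
  congr 2
  simp only [inner_sub_right, real_inner_comm w.2 z.1, real_inner_comm z.2 w.1]
  push_cast
  ring

theorem rho_rho_ae_eq (z w : Phase d) (f : L2 d) :
    rho z (rho w f) =ᵐ[volume] shiftFun z (shiftFun w f) := by
  filter_upwards [coeFn_rho z (rho w f), ae_shift z.1 (coeFn_rho w f)] with t h1 h2
  rw [h1, shiftFun, h2]
  rfl

/-- The Weyl commutation relation: applying `ρ(w)` to both `f` and `g` only multiplies `⟨ρ(z) f, g⟩`
by a symplectic character. -/
theorem rho_comm (z w : Phase d) (f : L2 d) :
    rho z (rho w f) = symplecticChar w z • rho w (rho z f) := by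
  apply Lp.ext
  filter_upwards [rho_rho_ae_eq z w f, rho_rho_ae_eq w z f,
    Lp.coeFn_smul (symplecticChar w z) (rho w (rho z f))] with t h1 h2 h3
  rw [h1, h3, Pi.smul_apply, h2, shiftFun_shiftFun, smul_eq_mul]

/-- The Gaussian `e^{-π |t|²}`. -/
def gaussianFun (t : Config d) : ℂ := Complex.exp (-(Real.pi : ℂ) * ‖t‖ ^ 2)

theorem norm_gaussianFun (t : Config d) : ‖gaussianFun t‖ = Real.exp (-Real.pi * ‖t‖ ^ 2) := by
  rw [gaussianFun, Complex.norm_exp]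
  congr 1
  rw [← Complex.ofReal_pow, ← Complex.ofReal_neg, ← Complex.ofReal_mul, Complex.ofReal_re]

theorem memLp_gaussianFun : MemLp (gaussianFun (d := d)) 2 volume := by
  rw [memLp_two_iff_integrable_sq_norm
    (Continuous.aestronglyMeasurable (by unfold gaussianFun; fun_prop))]
  have h := (GaussianFourier.integrable_cexp_neg_mul_sq_norm_add (V := Config d)
    (b := (2 * Real.pi : ℝ)) (by simp [Real.pi_pos]) 0 0).norm
  refine h.congr (Eventually.of_forall fun t => ?_)
  simp only [norm_gaussianFun, zero_mul, add_zero, ← Real.exp_nat_mul, Complex.norm_exp]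
  congr 1
  rw [← Complex.ofReal_pow, ← Complex.ofReal_neg, ← Complex.ofReal_mul, Complex.ofReal_re]
  push_cast
  ring

/-- The Gaussian `e^{-π |t|²}` as an element of `L²`. -/
def gaussian (d : ℕ) : L2 d := memLp_gaussianFun.toLp gaussianFun

-- By completing the square, the product of the Gaussian with its translate by `x` is a multiple of
-- a Gaussian centred at `x/2`. The Fourier transform of a Gaussian has no zeros.
open FourierTransform in
theorem inner_rho_gaussian_ne_zero (z : Phase d) : ⟪rho z (gaussian d), gaussian d⟫_ℂ ≠ 0 := by
  rw [← enorm_ne_zero, ← Prod.mk.eta (p := z), enorm_inner_rho_eq, enorm_ne_zero]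
  have hg : (gaussian d : Config d → ℂ) =ᵐ[volume] gaussianFun :=
    memLp_gaussianFun.coeFn_toLp
  have key : (fun t => gaussian d t * (starRingEnd ℂ) (gaussian d (t - z.1))) =ᵐ[volume]
      Complex.exp (-Real.pi / 2 * ‖z.1‖ ^ 2) •
        ((fun t => Complex.exp (-(2 * Real.pi : ℝ) * ‖t‖ ^ 2)) ∘
          fun t => t + (-(2⁻¹ : ℝ)) • z.1) := by
    filter_upwards [hg, ae_shift z.1 hg] with t h1 h2
    rw [h1, h2]
    simp only [gaussianFun, ← Complex.exp_conj, map_mul, map_neg, Complex.conj_ofReal, map_pow,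
      Pi.smul_apply, Function.comp_apply, smul_eq_mul, ← Complex.exp_add]
    congr 1
    have e1 := norm_sub_sq_real t z.1
    have e2 := norm_add_sq_real t ((-(2⁻¹ : ℝ)) • z.1)
    rw [norm_smul, inner_smul_right, mul_pow] at e2
    norm_num at e2
    norm_cast
    rw [e1, show t + (-(2⁻¹ : ℝ)) • z.1 = t + -((1 / 2 : ℝ) • z.1) by norm_num, e2]
    ring
  have hF : 𝓕 (fun t => gaussian d t * (starRingEnd ℂ) (gaussian d (t - z.1))) z.2 =
      𝓕 (Complex.exp (-Real.pi / 2 * ‖z.1‖ ^ 2) •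
        ((fun t : Config d => Complex.exp (-(2 * Real.pi : ℝ) * ‖t‖ ^ 2)) ∘
          fun t => t + (-(2⁻¹ : ℝ)) • z.1)) z.2 := by
    rw [Real.fourier_eq, Real.fourier_eq]
    refine integral_congr_ae ?_
    filter_upwards [key] with t ht
    rw [ht]
  have hcst : ∀ (c : ℂ) (u : Config d → ℂ), 𝓕 (c • u) z.2 = c * 𝓕 u z.2 := fun c u => by
    rw [Real.fourier_eq, Real.fourier_eq, ← integral_const_mul]
    refine integral_congr_ae (Eventually.of_forall fun t => ?_)
    simp only [Pi.smul_apply, smul_eq_mul, Circle.smul_def]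
    ring
  have htr : ∀ (v : Config d) (u : Config d → ℂ),
      𝓕 (u ∘ fun t => t + v) z.2 = Real.fourierChar ⟪v, z.2⟫_ℝ • 𝓕 u z.2 := fun v u =>
    congrFun (VectorFourier.fourierIntegral_comp_add_right Real.fourierChar volume
      (innerₗ (Config d)) u v) z.2
  have hpi : (Real.pi : ℂ) ≠ 0 := by exact_mod_cast Real.pi_ne_zero
  rw [hF, hcst, htr, fourier_gaussian_innerProductSpace (by simp [Real.pi_pos])]
  refine mul_ne_zero (Complex.exp_ne_zero _) ?_
  rw [Circle.smul_def, smul_eq_mul]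
  refine mul_ne_zero (Circle.coe_ne_zero _) (mul_ne_zero ?_ (Complex.exp_ne_zero _))
  rw [Complex.cpow_ne_zero_iff]
  left
  push_cast
  exact div_ne_zero hpi (mul_ne_zero two_ne_zero hpi)

/-- Testing with `f = g = ρ(w) γ` for all `w` shows that the symplectic Fourier transform of `h ·
conj ⟨ρ(z) γ, γ⟩` vanishes. The second factor has no zeros, so `h = 0`. -/
theorem eq_zero_of_inner_amb_eq_zero {h : L2Phase d} (hh : ∀ f g, ⟪amb f g, h⟫_ℂ = 0) :
    h = 0 := by
  set γ := gaussian d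
  have hae : (fun z => h z * (starRingEnd ℂ) ⟪rho z γ, γ⟫_ℂ) =ᵐ[volume] 0 := by
    refine ae_eq_zero_of_integral_symplecticChar ?_ ?_
    · exact (Lp.memLp h).integrable_mul (memLp_inner_rho γ γ).star
    · intro w
      rw [← hh (rho w γ) (rho w γ), L2.inner_def]
      refine integral_congr_ae ?_
      filter_upwards [coeFn_amb (rho w γ) (rho w γ)] with z hz
      rw [hz, RCLike.inner_apply, rho_comm, inner_smul_left, inner_rho_rho, map_mul,
        Complex.conj_conj]
      ring
  apply Lp.ext
  filter_upwards [hae, Lp.coeFn_zero ℂ 2 (volume : Measure (Phase d))] with z h1 h2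
  rw [h2, Pi.zero_apply]
  have h3 : (starRingEnd ℂ) ⟪rho z γ, γ⟫_ℂ ≠ 0 := by
    rw [ne_eq, map_eq_zero]
    exact inner_rho_gaussian_ne_zero z
  exact (mul_eq_zero.mp h1).resolve_right h3

theorem topologicalClosure_span_amb :
    (Submodule.span ℂ (Set.range fun p : L2 d × L2 d => amb p.1 p.2)).topologicalClosure = ⊤ := by
  rw [Submodule.topologicalClosure_eq_top_iff, Submodule.eq_bot_iff]
  intro h hh
  refine eq_zero_of_inner_amb_eq_zero fun f g => ?_
  exact hh _ (Submodule.subset_span ⟨(f, g), rfl⟩)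

/-! ### Operators with a square integrable symbol -/

theorem norm_adjoint_amb_apply_le (f : L2 d) (h : L2Phase d) :
    ‖ContinuousLinearMap.adjoint (amb f) h‖ ≤ ‖h‖ * ‖f‖ := by
  rw [mul_comm]
  refine (ContinuousLinearMap.le_opNorm _ _).trans ?_
  rw [LinearIsometryEquiv.norm_map]
  gcongr
  exact ContinuousLinearMap.opNorm_le_bound _ (norm_nonneg f) fun g => (norm_amb f g).le

/-- The operator `∫ h(z) ρ(z) dz`, as a weak integral, for `h ∈ L²(ℝ^{2d})`. -/
def weyl (h : L2Phase d) : Op d :=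
  LinearMap.mkContinuous
    { toFun := fun f => ContinuousLinearMap.adjoint (amb f) h
      map_add' := fun f f' => ext_inner_left ℂ fun g => by
        simp only [inner_add_right, ContinuousLinearMap.adjoint_inner_right, amb_add,
          inner_add_left]
      map_smul' := fun c f => ext_inner_left ℂ fun g => by
        simp only [RingHom.id_apply, inner_smul_right, ContinuousLinearMap.adjoint_inner_right,
          amb_smul, inner_smul_left, Complex.conj_conj] }
    ‖h‖ (fun f => norm_adjoint_amb_apply_le f h)

theorem weyl_apply (h : L2Phase d) (f : L2 d) :
    weyl h f = ContinuousLinearMap.adjoint (amb f) h := rfl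

theorem inner_weyl (h : L2Phase d) (f g : L2 d) : ⟪g, weyl h f⟫_ℂ = ⟪amb f g, h⟫_ℂ := by
  rw [weyl_apply, ContinuousLinearMap.adjoint_inner_right]

theorem norm_weyl_le (h : L2Phase d) : ‖weyl h‖ ≤ ‖h‖ :=
  ContinuousLinearMap.opNorm_le_bound _ (norm_nonneg h) fun f => norm_adjoint_amb_apply_le f h

theorem op_ext {A B : Op d} (h : ∀ f g, ⟪g, A f⟫_ℂ = ⟪g, B f⟫_ℂ) : A = B :=
  ContinuousLinearMap.ext fun f => ext_inner_left ℂ fun g => h f g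

theorem weyl_add (h h' : L2Phase d) : weyl (h + h') = weyl h + weyl h' :=
  op_ext fun f g => by simp only [inner_weyl, inner_add_right, add_apply]

theorem weyl_smul (c : ℂ) (h : L2Phase d) : weyl (c • h) = c • weyl h :=
  op_ext fun f g => by simp only [inner_weyl, inner_smul_right, smul_apply]

theorem weyl_injective : Function.Injective (weyl (d := d)) := fun h h' hh => by
  rw [← sub_eq_zero]
  refine eq_zero_of_inner_amb_eq_zero fun f g => ?_
  rw [inner_sub_right, ← inner_weyl, ← inner_weyl, hh, sub_self]

/-- `weyl` as a bounded linear map. -/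
def weylL (d : ℕ) : L2Phase d →L[ℂ] Op d :=
  LinearMap.mkContinuous ⟨⟨weyl, weyl_add⟩, weyl_smul⟩ 1 fun h => by
    rw [one_mul]
    exact norm_weyl_le h

theorem weylL_apply (h : L2Phase d) : weylL d h = weyl h := rfl

theorem weyl_amb_apply (η e f : L2 d) : weyl (amb η e) f = ⟪η, f⟫_ℂ • e :=
  ext_inner_left ℂ fun g => by rw [inner_weyl, inner_amb_amb, inner_smul_right]

/-- Rank one symbols span a dense subspace, `weyl` is continuous into the operator norm, and compact
operators form a closed set. -/
theorem isCompactOperator_weyl (h : L2Phase d) : IsCompactOperator (weyl h) := by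
  have hcl : IsClosed {h : L2Phase d | IsCompactOperator (weyl h)} :=
    isClosed_setOfPred_isCompactOperator.preimage (weylL d).continuous
  have hspan : ∀ h ∈ Submodule.span ℂ (Set.range fun p : L2 d × L2 d => amb p.1 p.2),
      IsCompactOperator (weyl h) := by
    intro h hh
    induction hh using Submodule.span_induction with
    | mem x hx =>
      obtain ⟨⟨η, e⟩, rfl⟩ := hx
      have h1 : (weyl (amb η e) : L2 d → L2 d) =
          ContinuousLinearMap.toSpanSingleton ℂ e ∘ innerSL ℂ η := by
        ext1 f
        simp [weyl_amb_apply]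
      rw [h1]
      have h2 : IsCompactOperator (innerSL ℂ η : L2 d → ℂ) :=
        isCompactOperator_of_locallyCompactSpace_dom (innerSL ℂ η)
      exact h2.clm_comp _
    | zero =>
      rw [← weylL_apply, map_zero]
      exact isCompactOperator_zero
    | add x y _ _ hx hy =>
      rw [weyl_add]
      exact hx.add hy
    | smul c x _ hx =>
      rw [weyl_smul]
      exact hx.smul c
  have hmem : h ∈ closure (Submodule.span ℂ
      (Set.range fun p : L2 d × L2 d => amb p.1 p.2) : Set (L2Phase d)) := by
    rw [← Submodule.topologicalClosure_coe, topologicalClosure_span_amb]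
    trivial
  exact closure_minimal hspan hcl hmem

/-! ### Singular value decompositions -/

/-- A compact operator maps some orthonormal basis to an orthogonal family. -/
theorem exists_hilbertBasis_orthogonal_image {T : Op d} (hT : IsCompactOperator T) :
    ∃ (ι : Type) (b : HilbertBasis ι ℂ (L2 d)),
      Pairwise fun i j => ⟪T (b i), T (b j)⟫_ℂ = 0 := by
  set B : Op d := ContinuousLinearMap.adjoint T ∘L T with hB
  have hBc : IsCompactOperator B := hT.clm_comp (ContinuousLinearMap.adjoint T)
  have hBi : ∀ f g, ⟪B f, g⟫_ℂ = ⟪T f, T g⟫_ℂ := fun f g => by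
    rw [hB, ContinuousLinearMap.comp_apply, ContinuousLinearMap.adjoint_inner_left]
  have hBs : (B : L2 d →ₗ[ℂ] L2 d).IsSymmetric := fun f g => by
    rw [ContinuousLinearMap.coe_coe, hBi, ← inner_conj_symm f, hBi, inner_conj_symm]
  let V (μ : ℂ) := Module.End.eigenspace (B : Module.End ℂ (L2 d)) μ
  have hVc : ∀ μ, CompleteSpace (V μ) := by
    intro μ
    have : IsClosed (V μ : Set (L2 d)) := by
      have : (V μ : Set (L2 d)) = {f | B f = μ • f} := by
        ext f
        simp [V]
      rw [this]
      exact isClosed_eq B.continuous (continuous_const_smul μ)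
    exact this.completeSpace_coe
  -- Orthonormal bases of all eigenspaces of `T^* T`, the kernel included, combine to a basis by the
  -- spectral theorem. On it `⟨T bᵢ, T bⱼ⟩ = ⟨T^* T bᵢ, bⱼ⟩` vanishes off the diagonal.
  choose w c _ using fun μ => exists_hilbertBasis ℂ (V μ)
  have hon := hBs.orthogonalFamily_eigenspaces.orthonormal_sigma_orthonormal
    (fun μ => (c μ).orthonormal)
  have hsp : (Submodule.span ℂ (Set.range fun a : Σ μ, w μ =>
      ((V a.1).subtypeₗᵢ (c a.1 a.2))))ᗮ = ⊥ := by
    rw [eq_bot_iff, ← ContinuousLinearMap.orthogonalComplement_iSup_eigenspaces_eq_bot hBc hBs]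
    intro x hx
    rw [Submodule.mem_orthogonal] at hx
    rw [← Submodule.iInf_orthogonal, Submodule.mem_iInf]
    intro μ
    rw [Submodule.mem_orthogonal]
    intro y hy
    have h1 := (((c μ).hasSum_repr ⟨y, hy⟩).mapL (V μ).subtypeL).mapL (innerSLFlip ℂ x)
    have h2 : ∀ i, innerSLFlip ℂ x ((V μ).subtypeL ((c μ).repr ⟨y, hy⟩ i • c μ i)) = 0 := by
      intro i
      have h3 : ⟪((c μ i : V μ) : L2 d), x⟫_ℂ = 0 := hx _ (Submodule.subset_span ⟨⟨μ, i⟩, rfl⟩)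
      rw [map_smul, Submodule.subtypeL_apply]
      simp [h3]
    simp only [h2] at h1
    exact (hasSum_zero.unique h1).symm
  refine ⟨_, HilbertBasis.mkOfOrthogonalEqBot hon hsp, fun i j hij => ?_⟩
  rw [HilbertBasis.coe_mkOfOrthogonalEqBot]
  have h1 : B (c i.1 i.2 : L2 d) = i.1 • (c i.1 i.2 : L2 d) :=
    Module.End.mem_eigenspace_iff.mp (c i.1 i.2).2
  have h2 : ⟪(c i.1 i.2 : L2 d), (c j.1 j.2 : L2 d)⟫_ℂ = 0 := hon.2 hij
  change ⟪T (c i.1 i.2 : L2 d), T (c j.1 j.2 : L2 d)⟫_ℂ = 0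
  rw [← hBi, h1, inner_smul_left, h2, mul_zero]

section Orthogonal

variable {E ι : Type*} [NormedAddCommGroup E] [InnerProductSpace ℂ E]

theorem orthogonalFamily_span_singleton {y : ι → E} (hy : Pairwise fun i j => ⟪y i, y j⟫_ℂ = 0) :
    OrthogonalFamily ℂ (fun i => (ℂ ∙ y i : Submodule ℂ E)) fun i => (ℂ ∙ y i).subtypeₗᵢ := by
  rintro i j hij ⟨v, hv⟩ ⟨w, hw⟩
  obtain ⟨a, rfl⟩ := Submodule.mem_span_singleton.mp hv
  obtain ⟨b, rfl⟩ := Submodule.mem_span_singleton.mp hw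
  simp [inner_smul_left, inner_smul_right, hy hij]

theorem summable_of_orthogonal [CompleteSpace E] {y : ι → E}
    (hy : Pairwise fun i j => ⟪y i, y j⟫_ℂ = 0) (hs : Summable fun i => ‖y i‖ ^ 2) :
    Summable y :=
  ((orthogonalFamily_span_singleton hy).summable_iff_norm_sq_summable
    fun i => ⟨y i, Submodule.mem_span_singleton_self _⟩).2 hs

theorem hasSum_norm_sq_of_orthogonal {y : ι → E} {h : E}
    (hy : Pairwise fun i j => ⟪y i, y j⟫_ℂ = 0) (hs : HasSum y h) :
    HasSum (fun i => ‖y i‖ ^ 2) (‖h‖ ^ 2) := by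
  refine (((continuous_norm.pow 2).tendsto h).comp hs).congr fun F => ?_
  exact (orthogonalFamily_span_singleton hy).norm_sum
    (fun i => ⟨y i, Submodule.mem_span_singleton_self _⟩) F

end Orthogonal

/-- The terms of the symbol of `T = ∑ₙ sₙ eₙ ⊗ ηₙ`. -/
def symbolTerm (s : ℕ → ℝ≥0) (e η : ℕ → L2 d) (n : ℕ) : L2Phase d :=
  ((s n : ℝ) : ℂ) • amb (η n) (e n)

namespace IsSVD

variable {T : Op d} {s : ℕ → ℝ≥0} {e η : ℕ → L2 d}

theorem norm_left (h : IsSVD T s e η) {n : ℕ} (hn : s n ≠ 0) : ‖e n‖ = 1 :=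
  h.orthonormal_left.1 ⟨n, hn⟩

theorem norm_right (h : IsSVD T s e η) {n : ℕ} (hn : s n ≠ 0) : ‖η n‖ = 1 :=
  h.orthonormal_right.1 ⟨n, hn⟩

theorem inner_left (h : IsSVD T s e η) {n k : ℕ} (hn : s n ≠ 0) (hk : s k ≠ 0) (hnk : n ≠ k) :
    ⟪e n, e k⟫_ℂ = 0 :=
  h.orthonormal_left.2 (i := ⟨n, hn⟩) (j := ⟨k, hk⟩) fun hc => hnk (congrArg Subtype.val hc)

theorem inner_right (h : IsSVD T s e η) {n k : ℕ} (hn : s n ≠ 0) (hk : s k ≠ 0) (hnk : n ≠ k) :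
    ⟪η n, η k⟫_ℂ = 0 :=
  h.orthonormal_right.2 (i := ⟨n, hn⟩) (j := ⟨k, hk⟩) fun hc => hnk (congrArg Subtype.val hc)

theorem apply_right (h : IsSVD T s e η) {n : ℕ} (hn : s n ≠ 0) :
    T (η n) = ((s n : ℝ) : ℂ) • e n := by
  refine (h.hasSum (η n)).unique ?_
  have h1 := hasSum_single (f := fun k => ((s k : ℝ) : ℂ) • (⟪η k, η n⟫_ℂ • e k)) n
    fun k hk => by
      by_cases hk0 : s k = 0
      · simp [hk0]
      · simp [h.inner_right hk0 hn hk]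
  rwa [inner_self_eq_norm_sq_to_K, h.norm_right hn, RCLike.ofReal_one, one_pow, one_smul] at h1

theorem pairwise_symbolTerm (h : IsSVD T s e η) :
    Pairwise fun i j => ⟪symbolTerm s e η i, symbolTerm s e η j⟫_ℂ = 0 := by
  intro i j hij
  by_cases hi : s i = 0
  · simp [symbolTerm, hi]
  by_cases hj : s j = 0
  · simp [symbolTerm, hj]
  rw [symbolTerm, symbolTerm, inner_smul_left, inner_smul_right, inner_amb_amb,
    h.inner_left hi hj hij, mul_zero, mul_zero, mul_zero]

theorem norm_symbolTerm (h : IsSVD T s e η) (n : ℕ) : ‖symbolTerm s e η n‖ = s n := by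
  by_cases hn : s n = 0
  · simp [symbolTerm, hn]
  · rw [symbolTerm, norm_smul, norm_amb, h.norm_left hn, h.norm_right hn, mul_one, mul_one,
      Complex.norm_real, Real.norm_eq_abs, NNReal.abs_eq]

theorem weyl_of_hasSum_symbolTerm (h : IsSVD T s e η) {u : L2Phase d}
    (hu : HasSum (symbolTerm s e η) u) : weyl u = T := by
  refine op_ext fun f g => ?_
  rw [inner_weyl]
  refine ((hu.mapL (innerSL ℂ (amb f g))).unique ?_)
  convert! (h.hasSum f).mapL (innerSL ℂ g) using 1
  ext n
  simp only [symbolTerm, innerSL_apply_apply, inner_smul_right, inner_amb_amb]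

/-- By Moyal's identity the symbol terms are orthogonal of norm `sₙ`, so square summability makes
the symbol series converge in `L²`. -/
theorem exists_weyl_eq (h : IsSVD T s e η) (hs : Summable fun n => (s n : ℝ) ^ 2) :
    ∃ u : L2Phase d, weyl u = T ∧ HasSum (symbolTerm s e η) u ∧
      HasSum (fun n => (s n : ℝ) ^ 2) (‖u‖ ^ 2) := by
  have h1 : Summable (symbolTerm s e η) :=
    summable_of_orthogonal h.pairwise_symbolTerm (by simpa only [h.norm_symbolTerm] using hs)
  refine ⟨_, h.weyl_of_hasSum_symbolTerm h1.hasSum, h1.hasSum, ?_⟩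
  simpa only [h.norm_symbolTerm] using hasSum_norm_sq_of_orthogonal h.pairwise_symbolTerm h1.hasSum

/-- The operator `weyl u` is Hilbert-Schmidt. -/
theorem summable_sq {u : L2Phase d} (h : IsSVD (weyl u) s e η) :
    Summable fun n => (s n : ℝ) ^ 2 := by
  have hon : Orthonormal ℂ fun n : {n : ℕ // s n ≠ 0} => amb (η n) (e n) := by
    refine ⟨fun n => ?_, fun n k hnk => ?_⟩
    · rw [norm_amb, h.norm_right n.2, h.norm_left n.2, one_mul]
    · beta_reduce
      rw [inner_amb_amb, h.inner_left n.2 k.2 (fun hc => hnk (Subtype.ext hc)), mul_zero]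
  -- Bessel's inequality for `u`; its coefficient along `amb ηₙ eₙ` is `⟨eₙ, T ηₙ⟩ = sₙ`.
  have h1 := hon.inner_products_summable u
  have h2 : ∀ n : {n : ℕ // s n ≠ 0}, ‖⟪amb (η n) (e n), u⟫_ℂ‖ ^ 2 = (s n : ℝ) ^ 2 := by
    intro n
    rw [← inner_weyl, h.apply_right n.2, inner_smul_right, inner_self_eq_norm_sq_to_K,
      h.norm_left n.2]
    simp
  simp only [h2] at h1
  refine (Subtype.val_injective.summable_iff fun n hn => ?_).mp h1
  by_cases h0 : s n = 0
  · simp [h0]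
  · exact absurd ⟨⟨n, h0⟩, rfl⟩ hn

/-- Injectivity of `weyl` identifies the sum of the symbol series with `u`. Thus every singular
value decomposition yields the same value `‖u‖²`. -/
theorem hasSum_sq {u : L2Phase d} (h : IsSVD (weyl u) s e η) :
    HasSum (symbolTerm s e η) u ∧ HasSum (fun n => (s n : ℝ) ^ 2) (‖u‖ ^ 2) := by
  obtain ⟨u', h1, h2, h3⟩ := h.exists_weyl_eq h.summable_sq
  obtain rfl := weyl_injective h1
  exact ⟨h2, h3⟩

end IsSVD

/-- Decompositions over any countable index set are transported to `ℕ` by an injection and padded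
with zeros, which contribute `0 ^ p = 0` since `p > 0`. -/
theorem exists_isSVD_of_countable {ι : Type*} [Countable ι] {T : Op d} {s : ι → ℝ≥0}
    {e η : ι → L2 d} (hs : Summable fun i => (s i : ℝ) ^ 2) (he : Orthonormal ℂ e)
    (hη : Orthonormal ℂ η)
    (hT : ∀ f, HasSum (fun i => ((s i : ℝ) : ℂ) • (⟪η i, f⟫_ℂ • e i)) (T f)) :
    ∃ s' e' η', IsSVD T s' e' η' ∧
      ∀ p : ℝ, 0 < p → ∑' n, (s' n : ℝ≥0∞) ^ p = ∑' i, (s i : ℝ≥0∞) ^ p := by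
  obtain ⟨j, hj⟩ := Countable.exists_injective_nat ι
  have hmem : ∀ n, Function.extend j s 0 n ≠ 0 → ∃ i, j i = n := fun n hn => by
    by_contra hc
    exact hn (by rw [Function.extend_apply' _ _ _ hc]; rfl)
  let g : {n : ℕ // Function.extend j s 0 n ≠ 0} → ι := fun n => (hmem n n.2).choose
  have hg : ∀ n, j (g n) = n := fun n => (hmem n n.2).choose_spec
  have hgi : Function.Injective g := fun n k hnk => Subtype.ext (by rw [← hg n, hnk, hg k])
  refine ⟨Function.extend j s 0, Function.extend j e 0, Function.extend j η 0,
    ⟨?_, ?_, ?_, ?_⟩, fun p hp => ?_⟩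
  · have h1 : Summable fun n => ((Function.extend j s 0 n : ℝ≥0) : ℝ) ^ 2 := by
      rw [← hj.summable_iff]
      · simpa only [Function.comp_def, hj.extend_apply] using hs
      · intro n hn
        rw [Function.extend_apply' _ _ _ hn]
        simp
    have h2 := h1.tendsto_atTop_zero.sqrt
    simp only [Real.sqrt_sq NNReal.zero_le_coe, Real.sqrt_zero] at h2
    exact NNReal.tendsto_coe.mp h2
  · convert! he.comp g hgi using 1
    ext1 n
    rw [← hg n, hj.extend_apply, Function.comp_apply]
  · convert! hη.comp g hgi using 1
    ext1 n
    rw [← hg n, hj.extend_apply, Function.comp_apply]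
  · intro f
    rw [← hj.hasSum_iff]
    · simpa only [Function.comp_def, hj.extend_apply] using hT f
    · intro n hn
      rw [Function.extend_apply' _ _ _ hn]
      simp
  · rw [← hj.tsum_eq]
    · simp only [hj.extend_apply]
    · intro n hn
      by_contra hc
      apply hn
      simp only [Function.extend_apply' _ _ _ hc, Pi.zero_apply, ENNReal.coe_zero]
      exact ENNReal.zero_rpow_of_pos hp

theorem exists_isSVD_weyl (u : L2Phase d) : ∃ s e η, IsSVD (weyl u) s e η := by
  obtain ⟨ι, b, hb⟩ := exists_hilbertBasis_orthogonal_image (isCompactOperator_weyl u)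
  set T := weyl u with hTu
  let S := {i : ι // T (b i) ≠ 0}
  let e : S → L2 d := fun i => ((‖T (b i)‖⁻¹ : ℝ) : ℂ) • T (b i)
  have hn0 : ∀ i : S, ‖T (b i)‖ ≠ 0 := fun i => norm_ne_zero_iff.mpr i.2
  have hη : Orthonormal ℂ fun i : S => b i := b.orthonormal.comp _ Subtype.val_injective
  have he : Orthonormal ℂ e := by
    refine ⟨fun i => ?_, fun i k hik => ?_⟩
    · simp only [e, norm_smul, Complex.norm_real, norm_inv, norm_norm]
      exact inv_mul_cancel₀ (hn0 i)
    · simp only [e, inner_smul_left, inner_smul_right]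
      rw [hb fun hc => hik (Subtype.ext hc)]
      simp
  have hTe : ∀ i : S, T (b i) = ((‖T (b i)‖ : ℝ) : ℂ) • e i := fun i => by
    simp only [e, smul_smul, ← Complex.ofReal_mul, mul_inv_cancel₀ (hn0 i), Complex.ofReal_one,
      one_smul]
  have hon : Orthonormal ℂ fun i : S => amb (b i) (e i) := by
    refine ⟨fun i => ?_, fun i k hik => ?_⟩
    · rw [norm_amb, hη.1 i, he.1 i, one_mul]
    · beta_reduce
      rw [inner_amb_amb, he.2 hik, mul_zero]
  have hsum : Summable fun i : S => ‖T (b i)‖ ^ 2 := by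
    refine (hon.inner_products_summable u).congr fun i => ?_
    rw [← inner_weyl, ← hTu, hTe i, inner_smul_right, inner_self_eq_norm_sq_to_K, he.1 i]
    rw [RCLike.ofReal_one, one_pow, mul_one, norm_smul, he.1 i, mul_one]
  have hcount : Countable S := by
    -- A summable family of nonzero terms has a countable index set, so separability of `L²` is not
    -- needed.
    have h1 := hsum.countable_support
    have h2 : (Function.support fun i : S => ‖T (b i)‖ ^ 2) = Set.univ :=
      Set.eq_univ_of_forall fun i => pow_ne_zero 2 (hn0 i)
    rw [h2, Set.countable_univ_iff] at h1
    exact h1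
  suffices h : ∀ f, HasSum (fun i : S => (((‖T (b i)‖₊ : ℝ≥0) : ℝ) : ℂ) • (⟪b i, f⟫_ℂ • e i))
      (T f) by
    obtain ⟨s', e', η', h', -⟩ := exists_isSVD_of_countable (s := fun i : S => ‖T (b i)‖₊) hsum
      he hη h
    exact ⟨s', e', η', h'⟩
  intro f
  have h1 := (b.hasSum_repr f).mapL T
  have h2 : ∀ i, T (b.repr f i • b i) = ⟪b i, f⟫_ℂ • T (b i) := fun i => by
    rw [map_smul, b.repr_apply_apply]
  simp only [h2] at h1
  have h3 := ((Subtype.val_injective (p := fun i => T (b i) ≠ 0)).hasSum_iff fun i hi => by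
    by_cases h0 : T (b i) = 0
    · rw [h0, smul_zero]
    · exact absurd ⟨⟨i, h0⟩, rfl⟩ hi).mpr h1
  refine h3.congr_fun fun i => ?_
  rw [Function.comp_apply, coe_nnnorm, smul_comm, ← hTe i]

/-! ### Schatten classes -/

theorem IsSVD.schattenNorm_le {T : Op d} {s : ℕ → ℝ≥0} {e η : ℕ → L2 d} (h : IsSVD T s e η)
    (p : ℝ) : schattenNorm p T ≤ (∑' n, (s n : ℝ≥0∞) ^ p) ^ (1 / p) :=
  iInf_le_of_le s (iInf_le_of_le e (iInf_le_of_le η (iInf_le_of_le h le_rfl)))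

theorem exists_isSVD_lt {p : ℝ} {T : Op d} {c : ℝ≥0∞} (hT : schattenNorm p T < c) :
    ∃ s e η, IsSVD T s e η ∧ (∑' n, (s n : ℝ≥0∞) ^ p) ^ (1 / p) < c := by
  simp only [schattenNorm, iInf_lt_iff] at hT
  obtain ⟨s, e, η, h, hc⟩ := hT
  exact ⟨s, e, η, h, hc⟩

theorem summable_rpow_of_tsum_lt_top {p : ℝ} (hp : 1 ≤ p) {s : ℕ → ℝ≥0}
    (hs : (∑' n, (s n : ℝ≥0∞) ^ p) ^ (1 / p) < ∞) : Summable fun n => (s n : ℝ) ^ p := by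
  have hp0 : 0 < p := by linarith
  have h1 : ∑' n, (s n : ℝ≥0∞) ^ p ≠ ∞ := fun hc => by
    rw [hc, ENNReal.top_rpow_of_pos (by positivity)] at hs
    exact lt_irrefl _ hs
  simp only [← ENNReal.coe_rpow_of_nonneg _ hp0.le] at h1
  have h2 := NNReal.summable_coe.mpr (ENNReal.tsum_coe_ne_top_iff_summable.mp h1)
  simpa only [NNReal.coe_rpow] using h2

theorem IsSVD.summable_sq_of_rpow {T : Op d} {s : ℕ → ℝ≥0} {e η : ℕ → L2 d} (h : IsSVD T s e η)
    {p : ℝ} (hp2 : p ≤ 2) (hs : Summable fun n => (s n : ℝ) ^ p) :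
    Summable fun n => (s n : ℝ) ^ 2 := by
  refine Summable.of_norm_bounded_eventually_nat hs ?_
  filter_upwards [h.tendsto_zero.eventually_lt_const one_pos] with n hn
  rw [Real.norm_of_nonneg (by positivity)]
  rcases eq_or_ne (s n) 0 with h0 | h0
  · rw [h0]
    simp only [NNReal.coe_zero, ne_eq, OfNat.ofNat_ne_zero, not_false_eq_true, zero_pow]
    positivity
  · have h1 : (0 : ℝ) < s n := by positivity
    have := Real.rpow_le_rpow_of_exponent_ge h1 (by exact_mod_cast hn.le) hp2
    exact_mod_cast this

theorem exists_weyl_eq_of_mem_schattenClass {p : ℝ} (hp : 1 ≤ p) (hp2 : p ≤ 2) {T : Op d}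
    (hT : T ∈ schattenClass d p) : ∃ u, weyl u = T := by
  obtain ⟨s, e, η, h, hs⟩ := exists_isSVD_lt hT
  obtain ⟨u, hu, -⟩ := h.exists_weyl_eq
    (h.summable_sq_of_rpow hp2 (summable_rpow_of_tsum_lt_top hp hs))
  exact ⟨u, hu⟩

theorem tsum_sq_of_hasSum {s : ℕ → ℝ≥0} {a : ℝ} (ha : 0 ≤ a)
    (h : HasSum (fun n => (s n : ℝ) ^ 2) (a ^ 2)) :
    (∑' n, (s n : ℝ≥0∞) ^ (2 : ℝ)) ^ (1 / (2 : ℝ)) = ENNReal.ofReal a := by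
  have h1 : ∑' n, (s n : ℝ≥0∞) ^ (2 : ℝ) = ENNReal.ofReal a ^ (2 : ℝ) := by
    rw [ENNReal.ofReal_rpow_of_nonneg ha two_pos.le, Real.rpow_two, ← h.tsum_eq,
      ENNReal.ofReal_tsum_of_nonneg (fun n => by positivity) h.summable]
    refine tsum_congr fun n => ?_
    rw [ENNReal.rpow_two, ENNReal.ofReal_pow NNReal.zero_le_coe, ENNReal.ofReal_coe_nnreal]
  rw [h1, ← ENNReal.rpow_mul]
  norm_num

/-- The Hilbert-Schmidt norm of an operator is the `L²` norm of its symbol. -/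
theorem schattenNorm_two_weyl (u : L2Phase d) :
    schattenNorm 2 (weyl u) = ENNReal.ofReal ‖u‖ := by
  refine le_antisymm ?_ ?_
  · obtain ⟨s, e, η, h⟩ := exists_isSVD_weyl u
    exact (h.schattenNorm_le 2).trans_eq (tsum_sq_of_hasSum (norm_nonneg u) h.hasSum_sq.2)
  · exact le_iInf fun s => le_iInf fun e => le_iInf fun η => le_iInf fun h =>
      (tsum_sq_of_hasSum (norm_nonneg u) h.hasSum_sq.2).ge

theorem isSVD_weyl_sum {s : ℕ → ℝ≥0} {e η : ℕ → L2 d} {N : ℕ} (hN : ∀ n, N ≤ n → s n = 0)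
    (he : Orthonormal ℂ fun n : {n : ℕ // s n ≠ 0} => e n)
    (hη : Orthonormal ℂ fun n : {n : ℕ // s n ≠ 0} => η n) :
    IsSVD (weyl (∑ n ∈ Finset.range N, symbolTerm s e η n)) s e η where
  tendsto_zero := tendsto_const_nhds.congr' <| by
    filter_upwards [eventually_ge_atTop N] with n hn
    rw [hN n hn]
  orthonormal_left := he
  orthonormal_right := hη
  hasSum f := by
    have h1 : weyl (∑ n ∈ Finset.range N, symbolTerm s e η n) f =
        ∑ n ∈ Finset.range N, ((s n : ℝ) : ℂ) • (⟪η n, f⟫_ℂ • e n) := by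
      rw [← weylL_apply, map_sum, sum_apply]
      refine Finset.sum_congr rfl fun n _ => ?_
      rw [weylL_apply, symbolTerm, weyl_smul, smul_apply, weyl_amb_apply]
    rw [h1]
    refine hasSum_sum_of_ne_finset_zero fun n hn => ?_
    rw [hN n (by simpa using hn)]
    simp

theorem tsum_rpow_lt_top_of_finite {s : ℕ → ℝ≥0} {N : ℕ} (hN : ∀ n, N ≤ n → s n = 0) {p : ℝ}
    (hp : 1 ≤ p) : (∑' n, (s n : ℝ≥0∞) ^ p) ^ (1 / p) < ∞ := by
  rw [tsum_eq_sum (s := Finset.range N) fun n hn => by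
    rw [hN n (by simpa using hn), ENNReal.coe_zero, ENNReal.zero_rpow_of_pos (by linarith)]]
  refine ENNReal.rpow_lt_top_of_nonneg (by positivity) (ENNReal.sum_lt_top.mpr fun n _ => ?_).ne
  exact ENNReal.rpow_lt_top_of_nonneg (by linarith) ENNReal.coe_ne_top

/-! ### The Fourier-Wigner transform of a trace class operator -/

theorem summable_norm_inner_mul_inner {x y : L2 d} (hx : ‖x‖ ≤ 1) (hy : ‖y‖ ≤ 1) :
    Summable (fun i => ‖⟪x, basis d i⟫_ℂ * ⟪basis d i, y⟫_ℂ‖) ∧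
      ∑' i, ‖⟪x, basis d i⟫_ℂ * ⟪basis d i, y⟫_ℂ‖ ≤ 1 := by
  have hb := (basis d).orthonormal
  have h1 := hb.inner_products_summable x
  have h2 := hb.inner_products_summable y
  have h3 := hb.tsum_inner_products_le x
  have h4 := hb.tsum_inner_products_le y
  have hle : ∀ i, ‖⟪x, basis d i⟫_ℂ * ⟪basis d i, y⟫_ℂ‖ ≤
      2⁻¹ * (‖⟪basis d i, x⟫_ℂ‖ ^ 2 + ‖⟪basis d i, y⟫_ℂ‖ ^ 2) := fun i => by
    rw [norm_mul, norm_inner_symm]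
    nlinarith [sq_nonneg (‖⟪basis d i, x⟫_ℂ‖ - ‖⟪basis d i, y⟫_ℂ‖)]
  have hs := (h1.add h2).mul_left (2⁻¹ : ℝ)
  have hsum := Summable.of_nonneg_of_le (fun i => norm_nonneg _) hle hs
  refine ⟨hsum, (hsum.tsum_le_tsum hle hs).trans ?_⟩
  rw [tsum_mul_left, h1.tsum_add h2]
  have := pow_le_one₀ (n := 2) (norm_nonneg x) hx
  have := pow_le_one₀ (n := 2) (norm_nonneg y) hy
  linarith

theorem IsSVD.hasSum_fourierWigner {T : Op d} {s : ℕ → ℝ≥0} {e η : ℕ → L2 d}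
    (h : IsSVD T s e η) (hs : Summable fun n => (s n : ℝ)) (z : Phase d) :
    HasSum (fun n => ((s n : ℝ) : ℂ) * ⟪rho z (η n), e n⟫_ℂ) (fourierWigner T z) := by
  -- A double series that is absolutely summable because row `n` is bounded by `sₙ`. Summing over
  -- `n` first gives the diagonal entries of the trace; summing over the basis first gives `sₙ ⟨ρ(z)
  -- ηₙ, eₙ⟩` by Parseval.
  let G : ℕ × basisIndex d → ℂ := fun q =>
    ((s q.1 : ℝ) : ℂ) * (⟪rho z (η q.1), basis d q.2⟫_ℂ * ⟪basis d q.2, e q.1⟫_ℂ)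
  have hG : ∀ n, Summable (fun i => ‖G (n, i)‖) ∧ ∑' i, ‖G (n, i)‖ ≤ s n := by
    intro n
    simp only [G, norm_mul ((s n : ℝ) : ℂ), Complex.norm_real, Real.norm_eq_abs, NNReal.abs_eq,
      tsum_mul_left]
    by_cases hn : s n = 0
    · simp only [hn, NNReal.coe_zero, zero_mul, le_refl, and_true]
      exact summable_zero
    · obtain ⟨h1, h2⟩ := summable_norm_inner_mul_inner (x := rho z (η n)) (y := e n)
        (by rw [norm_rho_apply, h.norm_right hn]) (h.norm_left hn).le
      exact ⟨h1.mul_left _, mul_le_of_le_one_right NNReal.zero_le_coe h2⟩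
  have hGs : Summable G := by
    refine Summable.of_norm ((summable_prod_of_nonneg fun q => norm_nonneg _).mpr
      ⟨fun n => (hG n).1, ?_⟩)
    exact Summable.of_nonneg_of_le (fun n => tsum_nonneg fun i => norm_nonneg _)
      (fun n => (hG n).2) hs
  have hi : ∀ i, HasSum (fun n => G (n, i))
      ⟪basis d i, (T ∘L ContinuousLinearMap.adjoint (rho z)) (basis d i)⟫_ℂ := by
    intro i
    have h1 := (h.hasSum (ContinuousLinearMap.adjoint (rho z) (basis d i))).mapL
      (innerSL ℂ (basis d i))
    refine h1.congr_fun fun n => ?_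
    simp only [G, innerSL_apply_apply, inner_smul_right, ContinuousLinearMap.adjoint_inner_right]
  have hn : ∀ n, HasSum (fun i => G (n, i)) (((s n : ℝ) : ℂ) * ⟪rho z (η n), e n⟫_ℂ) :=
    fun n => ((basis d).hasSum_inner_mul_inner _ _).mul_left _
  have h2 := hGs.hasSum.prod_fiberwise hn
  have h3 : fourierWigner T z = ∑' q, G q := by
    have h4 := (hGs.prod_symm.hasSum.prod_fiberwise hi).tsum_eq
    rw [fourierWigner, trace, h4]
    exact (Equiv.prodComm _ _).tsum_eq G
  rwa [h3]

theorem coeFn_sum_range (u : ℕ → L2Phase d) (N : ℕ) :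
    ∀ᵐ z, (∑ n ∈ Finset.range N, u n : L2Phase d) z = ∑ n ∈ Finset.range N, u n z := by
  induction N with
  | zero =>
    simp only [Finset.range_zero, Finset.sum_empty]
    exact Lp.coeFn_zero ℂ 2 volume
  | succ N ih =>
    simp only [Finset.sum_range_succ]
    filter_upwards [ih, Lp.coeFn_add (∑ n ∈ Finset.range N, u n) (u N)] with z h1 h2
    rw [h2, Pi.add_apply, h1]

/-- The symbol series converges to `u` in `L²`, hence almost everywhere along a subsequence. Its
pointwise formula converges to the Fourier-Wigner transform at every `z`. -/
theorem fourierWigner_weyl_ae_eq {u : L2Phase d} (hu : weyl u ∈ schattenClass d 1) :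
    fourierWigner (weyl u) =ᵐ[volume] u := by
  obtain ⟨s, e, η, h, hs⟩ := exists_isSVD_lt hu
  have hs1 : Summable fun n => (s n : ℝ) := by
    simpa using summable_rpow_of_tsum_lt_top le_rfl hs
  have h1 := (tendstoInMeasure_of_tendsto_Lp h.hasSum_sq.1.tendsto_sum_nat).exists_seq_tendsto_ae
  obtain ⟨k, hk, hae⟩ := h1
  have h2 : ∀ᵐ z, ∀ N, (∑ n ∈ Finset.range N, symbolTerm s e η n : L2Phase d) z =
      ∑ n ∈ Finset.range N, ((s n : ℝ) : ℂ) * ⟪rho z (η n), e n⟫_ℂ := by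
    rw [ae_all_iff]
    intro N
    have h3 : ∀ᵐ z, ∀ n, symbolTerm s e η n z = ((s n : ℝ) : ℂ) * ⟪rho z (η n), e n⟫_ℂ := by
      rw [ae_all_iff]
      intro n
      filter_upwards [coeFn_amb (η n) (e n), Lp.coeFn_smul ((s n : ℝ) : ℂ) (amb (η n) (e n))]
        with z hz1 hz2
      rw [symbolTerm, hz2, Pi.smul_apply, hz1, smul_eq_mul]
    filter_upwards [h3, coeFn_sum_range (symbolTerm s e η) N] with z h4 h5
    rw [h5]
    exact Finset.sum_congr rfl fun n _ => h4 n
  filter_upwards [hae, h2] with z hz1 hz2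
  simp only [hz2] at hz1
  exact tendsto_nhds_unique
    (((h.hasSum_fourierWigner hs1 z).tendsto_sum_nat).comp hk.tendsto_atTop) hz1

/-! ### Multiplication of symbols -/

/-- Multiplication by `m ∈ L^∞` on `L²`. -/
def mulL (m : LInf d) : L2Phase d →L[ℂ] L2Phase d :=
  LinearMap.mkContinuous
    { toFun := fun u => (m • u : L2Phase d)
      map_add' := fun u v => Lp.add_smul m u v
      map_smul' := fun c u => (Lp.smul_comm c m u).symm }
    ‖m‖ (fun u => Lp.norm_smul_le m u)

theorem coeFn_mulL (m : LInf d) (u : L2Phase d) : mulL m u =ᵐ[volume] fun z => m z * u z :=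
  Lp.coeFn_lpSMul m u

theorem norm_mulL_apply_le (m : LInf d) (u : L2Phase d) : ‖mulL m u‖ ≤ ‖m‖ * ‖u‖ :=
  Lp.norm_smul_le m u

theorem inner_mulL (m : LInf d) (u v : L2Phase d) :
    ⟪v, mulL m u⟫_ℂ = ∫ z, m z * u z * (starRingEnd ℂ) (v z) := by
  rw [L2.inner_def]
  refine integral_congr_ae ?_
  filter_upwards [coeFn_mulL m u] with z hz
  rw [hz, RCLike.inner_apply]

theorem integrable_mulL (m : LInf d) (u v : L2Phase d) :
    Integrable fun z => m z * u z * (starRingEnd ℂ) (v z) := by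
  refine (L2.integrable_inner (𝕜 := ℂ) v (mulL m u)).congr ?_
  filter_upwards [coeFn_mulL m u] with z hz
  rw [hz, RCLike.inner_apply]

/-- Indicators of sets `t` of finite measure give `∫_t |m|² ≤ C² |t|`, hence `|m| ≤ C` almost
everywhere. -/
theorem norm_le_of_norm_mulL_le {m : LInf d} {C : ℝ≥0} (h : ∀ u, ‖mulL m u‖ ≤ C * ‖u‖) :
    ‖m‖ ≤ C := by
  have hm : Measurable fun z => ‖m z‖ₑ ^ 2 :=
    ((Lp.stronglyMeasurable m).measurable.enorm).pow_const 2
  have hae : (fun z => ‖m z‖ₑ ^ 2) ≤ᵐ[volume] fun _ => (C : ℝ≥0∞) ^ 2 := by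
    refine ae_le_of_forall_setLIntegral_le_of_sigmaFinite hm fun t ht htfin => ?_
    rw [setLIntegral_const]
    set u : L2Phase d := indicatorConstLp 2 ht htfin.ne (1 : ℂ) with hu
    have h1 : eLpNorm (mulL m u) 2 volume ≤ C * eLpNorm u 2 volume := by
      have h2 := ENNReal.ofReal_le_ofReal (h u)
      rwa [ENNReal.ofReal_mul C.coe_nonneg, ofReal_norm, ofReal_norm, Lp.enorm_def, Lp.enorm_def,
        ENNReal.ofReal_coe_nnreal] at h2
    have h3 := pow_le_pow_left₀ (zero_le) h1 2
    have hu1 : eLpNorm u 2 volume ^ 2 = volume t := by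
      rw [sq_eLpNorm_two, ← setLIntegral_one, ← lintegral_indicator ht]
      refine lintegral_congr_ae ?_
      filter_upwards [indicatorConstLp_coeFn (p := 2) (hs := ht) (hμs := htfin.ne)
        (c := (1 : ℂ))] with z hz
      rw [hu, hz]
      by_cases hzt : z ∈ t <;> simp [hzt]
    have hu2 : eLpNorm (mulL m u) 2 volume ^ 2 = ∫⁻ z in t, ‖m z‖ₑ ^ 2 := by
      rw [sq_eLpNorm_two, ← lintegral_indicator ht]
      refine lintegral_congr_ae ?_
      filter_upwards [coeFn_mulL m u, indicatorConstLp_coeFn (p := 2) (hs := ht)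
        (hμs := htfin.ne) (c := (1 : ℂ))] with z hz1 hz2
      rw [hz1, hu, hz2]
      by_cases hzt : z ∈ t <;> simp [hzt]
    rwa [mul_pow, hu1, hu2] at h3
  rw [Lp.norm_def]
  refine ENNReal.toReal_le_coe_of_le_coe ?_
  rw [eLpNorm_exponent_top]
  refine eLpNormEssSup_le_of_ae_enorm_bound ?_
  filter_upwards [hae] with z hz
  exact (ENNReal.pow_right_strictMono two_ne_zero).le_iff_le.mp hz

/-! ### Multipliers -/

/-- Here `𝔗_m` becomes multiplication of symbols. It also shows that every extension is forced on
`𝓢^1`. -/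
theorem isMultiplierImage_weyl_iff (m : LInf d) {u : L2Phase d}
    (hu : weyl u ∈ schattenClass d 1) (A : Op d) :
    IsMultiplierImage m (weyl u) A ↔ A = weyl (mulL m u) := by
  have hae : ∀ f g : L2 d, (fun z => m z * fourierWigner (weyl u) z * ⟪g, rho z f⟫_ℂ) =ᵐ[volume]
      fun z => m z * u z * (starRingEnd ℂ) (amb f g z) := fun f g => by
    filter_upwards [fourierWigner_weyl_ae_eq hu, coeFn_amb f g] with z h1 h2
    rw [h1, h2, inner_conj_symm]
  have hint : ∀ f g : L2 d, ∫ z, m z * fourierWigner (weyl u) z * ⟪g, rho z f⟫_ℂ =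
      ⟪g, weyl (mulL m u) f⟫_ℂ := fun f g => by
    rw [integral_congr_ae (hae f g), inner_weyl, inner_mulL]
  constructor
  · intro h
    exact op_ext fun f g => by rw [(h f g).2, hint]
  · rintro rfl f g
    exact ⟨(integrable_mulL m u (amb f g)).congr (hae f g).symm, (hint f g).symm⟩

open Classical in
/-- The extension of the multiplier `𝔗_m` to the Hilbert-Schmidt operators. -/
def multiplierExt (m : LInf d) (T : Op d) : Op d :=
  if h : ∃ u, weyl u = T then weyl (mulL m h.choose) else 0

theorem multiplierExt_weyl (m : LInf d) (u : L2Phase d) :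
    multiplierExt m (weyl u) = weyl (mulL m u) := by
  have h : ∃ v, weyl v = weyl u := ⟨u, rfl⟩
  rw [multiplierExt, dif_pos h, weyl_injective h.choose_spec]

/-- Since the Schatten norm is an infimum, it suffices to bound the image through each
decomposition; the strictly positive bound `V` can later be divided by. -/
theorem isBoundedExtension_multiplierExt {p : ℝ} (hp : 1 ≤ p) (hp2 : p ≤ 2) {m : LInf d} {C : ℝ≥0}
    (hC : ∀ u s e η, IsSVD (weyl u) s e η → ∀ V : ℝ≥0, 0 < V →
      (∑' n, (s n : ℝ≥0∞) ^ p) ^ (1 / p) ≤ V → schattenNorm p (weyl (mulL m u)) ≤ C * V) :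
    IsBoundedExtension p p m (multiplierExt m) C where
  map_add S hS T hT := by
    obtain ⟨u, rfl⟩ := exists_weyl_eq_of_mem_schattenClass hp hp2 hS
    obtain ⟨v, rfl⟩ := exists_weyl_eq_of_mem_schattenClass hp hp2 hT
    rw [← weyl_add, multiplierExt_weyl, multiplierExt_weyl, multiplierExt_weyl, map_add, weyl_add]
  map_smul c T hT := by
    obtain ⟨u, rfl⟩ := exists_weyl_eq_of_mem_schattenClass hp hp2 hT
    rw [← weyl_smul, multiplierExt_weyl, multiplierExt_weyl, map_smul, weyl_smul]
  bound T hT := by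
    obtain ⟨u, rfl⟩ := exists_weyl_eq_of_mem_schattenClass hp hp2 hT
    rw [multiplierExt_weyl]
    refine le_of_forall_gt_imp_ge_of_dense fun c hc => ?_
    have h1 : ∃ c', schattenNorm p (weyl u) < c' ∧ C * c' ≤ c := by
      rcases eq_or_ne C 0 with h0 | h0
      -- For `C = 0` the quotient `c / C` is not available; `∞` works because `0 * ∞ = 0`.
      · exact ⟨∞, hT, by simp [h0]⟩
      · refine ⟨c / C, ?_, ?_⟩
        · rwa [ENNReal.lt_div_iff_mul_lt (by simp [h0]) (by simp), mul_comm]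
        · exact ENNReal.mul_div_le
    obtain ⟨c', hc1, hc2⟩ := h1
    obtain ⟨V, hV1, hV2⟩ := ENNReal.lt_iff_exists_nnreal_btwn.mp hc1
    obtain ⟨s, e, η, h, hs⟩ := exists_isSVD_lt hV1
    exact (hC u s e η h V (by exact_mod_cast zero_le.trans_lt hV1) hs.le).trans
      ((mul_le_mul_right hV2.le _).trans hc2)
  extends_multiplier T hT := by
    obtain ⟨u, rfl⟩ := exists_weyl_eq_of_mem_schattenClass le_rfl one_le_two hT
    rw [isMultiplierImage_weyl_iff m hT, multiplierExt_weyl]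

theorem isBoundedExtension_two (m : LInf d) :
    IsBoundedExtension 2 2 m (multiplierExt m) ‖m‖₊ :=
  isBoundedExtension_multiplierExt one_le_two le_rfl fun u s e η h V _ hV => by
    rw [schattenNorm_two_weyl]
    refine (ENNReal.ofReal_le_ofReal (norm_mulL_apply_le m u)).trans ?_
    rw [ENNReal.ofReal_mul (norm_nonneg m), ← coe_nnnorm m, ENNReal.ofReal_coe_nnreal]
    rw [tsum_sq_of_hasSum (norm_nonneg u) h.hasSum_sq.2] at hV
    gcongr

/-- The values of `Φ` are prescribed only on `𝓢^1`. The estimate is therefore read off on truncated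
decompositions, which have finite rank, and passes to the limit in `L²`. -/
theorem norm_le_of_isBoundedExtension_two {m : LInf d} {Φ : Op d → Op d} {C : ℝ≥0}
    (h : IsBoundedExtension 2 2 m Φ C) : ‖m‖ ≤ C := by
  refine norm_le_of_norm_mulL_le fun u => ?_
  obtain ⟨s, e, η, hsvd⟩ := exists_isSVD_weyl u
  have hlim := hsvd.hasSum_sq.1.tendsto_sum_nat
  have h1 := (((mulL m).continuous.tendsto u).comp hlim).norm
  refine le_of_tendsto_of_tendsto' h1 (hlim.norm.const_mul (C : ℝ)) fun N => ?_
  let s' : ℕ → ℝ≥0 := fun n => if n < N then s n else 0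
  have hs' : ∀ n, s' n ≠ 0 → s n ≠ 0 := fun n hn hc => hn (by simp [s', hc])
  have hN : ∀ n, N ≤ n → s' n = 0 := fun n hn => by simp [s', hn]
  let g : {n : ℕ // s' n ≠ 0} → {n : ℕ // s n ≠ 0} := fun n => ⟨n, hs' n n.2⟩
  have hg : Function.Injective g := fun a b hab => Subtype.ext (congrArg (fun x => x.1) hab)
  have hsum : ∑ n ∈ Finset.range N, symbolTerm s' e η n =
      ∑ n ∈ Finset.range N, symbolTerm s e η n :=
    Finset.sum_congr rfl fun n hn => by
      simp only [symbolTerm, s', Finset.mem_range.mp hn, if_true]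
  have h2 := isSVD_weyl_sum hN (hsvd.orthonormal_left.comp g hg)
    (hsvd.orthonormal_right.comp g hg)
  rw [hsum] at h2
  have hmem : ∀ p : ℝ, 1 ≤ p →
      weyl (∑ n ∈ Finset.range N, symbolTerm s e η n) ∈ schattenClass d p := fun p hp =>
    (h2.schattenNorm_le p).trans_lt (tsum_rpow_lt_top_of_finite hN hp)
  have h3 := (isMultiplierImage_weyl_iff m (hmem 1 le_rfl) _).mp
    (h.extends_multiplier _ (hmem 1 le_rfl))
  have h4 := h.bound _ (hmem 2 one_le_two)
  rw [h3, schattenNorm_two_weyl, schattenNorm_two_weyl, ← ENNReal.ofReal_coe_nnreal,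
    ← ENNReal.ofReal_mul C.coe_nonneg] at h4
  exact (ENNReal.ofReal_le_ofReal_iff (by positivity)).mp h4

theorem multipliers_two : multipliers d 2 = Set.univ :=
  Set.eq_univ_of_forall fun m => ⟨_, _, isBoundedExtension_two m⟩

theorem multiplierNorm_two (m : LInf d) : (multiplierNorm 2 m : ℝ) = ‖m‖ := by
  have h : multiplierNorm 2 m = ‖m‖₊ := by
    refine le_antisymm (csInf_le' ⟨_, isBoundedExtension_two m⟩)
      (le_csInf ⟨_, _, isBoundedExtension_two m⟩ ?_)
    rintro C ⟨Φ, hΦ⟩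
    exact_mod_cast norm_le_of_isBoundedExtension_two hΦ
  rw [h, coe_nnnorm]

/-! ### Parity and duality -/

/-- The parity operator `f(t) ↦ f(-t)`. -/
def parity (d : ℕ) : L2 d →ₗᵢ[ℂ] L2 d :=
  Lp.compMeasurePreservingₗᵢ ℂ (fun t : Config d => -t) (Measure.measurePreserving_neg volume)

theorem coeFn_parity (f : L2 d) : parity d f =ᵐ[volume] fun t => f (-t) :=
  Lp.coeFn_compMeasurePreserving f (Measure.measurePreserving_neg volume)

theorem shiftFun_neg (z : Phase d) (f : Config d → ℂ) (t : Config d) :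
    shiftFun z f (-t) = shiftFun (-z) (fun t => f (-t)) t := by
  simp only [shiftFun, Prod.fst_neg, Prod.snd_neg, inner_neg_left, inner_neg_right, neg_neg]
  rw [show -(t - -z.1) = -t - z.1 by abel]

theorem parity_rho (z : Phase d) (f : L2 d) :
    parity d (rho z f) = rho (-z) (parity d f) := by
  apply Lp.ext
  have h3 := (Measure.measurePreserving_neg (volume : Measure (Config d))).quasiMeasurePreserving.ae
    (coeFn_rho z f)
  filter_upwards [coeFn_parity (rho z f), coeFn_rho (-z) (parity d f), h3,
    ae_shift (-z).1 (coeFn_parity f)] with t h1 h2 h3 h4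
  rw [h1, h3, h2, shiftFun_neg, shiftFun, shiftFun, h4]

theorem rho_rho_neg (z : Phase d) (f : L2 d) : rho z (rho (-z) f) = f := by
  apply Lp.ext
  filter_upwards [rho_rho_ae_eq z (-z) f] with t h1
  rw [h1]
  simp only [shiftFun, Prod.fst_neg, Prod.snd_neg, inner_neg_left, inner_neg_right, neg_neg,
    sub_neg_eq_add, sub_add_cancel, inner_sub_right]
  rw [← mul_assoc, ← Complex.exp_add, ← Complex.exp_add, ← Complex.exp_add]
  convert! one_mul _
  rw [← Complex.exp_zero, real_inner_comm z.1 z.2]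
  congr 1
  push_cast
  ring

/-- Parity is isometric and intertwines `ρ(z)` with `ρ(-z) = ρ(z)^*`. -/
theorem inner_rho_parity (z : Phase d) (f g : L2 d) :
    ⟪rho z f, g⟫_ℂ = (starRingEnd ℂ) ⟪rho z (parity d g), parity d f⟫_ℂ := by
  rw [inner_conj_symm, ← (parity d).inner_map_map, parity_rho, ← inner_rho_rho z,
    rho_rho_neg]

/-- The two ambiguity functions exchange roles while `m` stays the same. So the trace form
`tr(𝔗_m(T) S)` is symmetric in `T` and `S` up to parity, which supplies the dual estimate. -/
theorem inner_mulL_parity (m : LInf d) (e η f g : L2 d) :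
    ⟪amb f g, mulL m (amb η e)⟫_ℂ =
      ⟪amb (parity d e) (parity d η), mulL m (amb (parity d g) (parity d f))⟫_ℂ := by
  rw [inner_mulL, inner_mulL]
  refine integral_congr_ae ?_
  filter_upwards [coeFn_amb f g, coeFn_amb η e, coeFn_amb (parity d e) (parity d η),
    coeFn_amb (parity d g) (parity d f)] with z h1 h2 h3 h4
  rw [h1, h2, h3, h4, inner_rho_parity z f g, inner_rho_parity z η e, Complex.conj_conj]
  ring

/-! ### Hölder's inequality for Schatten classes -/

/-- By Bessel, the matrix `W` has row and column sums at most `1`. The weighted inequality `t^(1-a)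
r^a ≤ (1-a) t + a r` then reduces the double sum to `∑ t` and `∑ r`. -/
theorem sum_mul_norm_inner_le {ι κ : Type*} [Fintype ι] [Fintype κ] {u v : ι → L2 d}
    {f g : κ → L2 d} (hu : Orthonormal ℂ u) (hv : Orthonormal ℂ v) (hf : Orthonormal ℂ f)
    (hg : Orthonormal ℂ g) {a : ℝ} (ha : 0 ≤ a) (ha1 : a ≤ 1) {r : ι → ℝ} {t : κ → ℝ}
    (hr0 : ∀ i, 0 ≤ r i) (ht0 : ∀ k, 0 ≤ t k) (hr : ∑ i, r i ≤ 1) (ht : ∑ k, t k ≤ 1) :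
    ∑ k, ∑ i, t k ^ (1 - a) * r i ^ a * (‖⟪v i, f k⟫_ℂ‖ * ‖⟪g k, u i⟫_ℂ‖) ≤ 1 := by
  set W : κ → ι → ℝ := fun k i => ‖⟪v i, f k⟫_ℂ‖ * ‖⟪g k, u i⟫_ℂ‖ with hW
  have hW0 : ∀ k i, 0 ≤ W k i := fun k i => by positivity
  have h1 : ∀ k, ∑ i, W k i ≤ 1 := fun k => by
    have e1 := hv.sum_inner_products_le (f k) (s := Finset.univ)
    have e2 := hu.sum_inner_products_le (g k) (s := Finset.univ)
    rw [hf.1 k] at e1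
    rw [hg.1 k] at e2
    have e3 : ∑ i, W k i ≤ ∑ i, 2⁻¹ * (‖⟪v i, f k⟫_ℂ‖ ^ 2 + ‖⟪u i, g k⟫_ℂ‖ ^ 2) := by
      refine Finset.sum_le_sum fun i _ => ?_
      rw [hW, norm_inner_symm (u i)]
      nlinarith [sq_nonneg (‖⟪v i, f k⟫_ℂ‖ - ‖⟪g k, u i⟫_ℂ‖)]
    rw [← Finset.mul_sum, Finset.sum_add_distrib] at e3
    linarith
  have h2 : ∀ i, ∑ k, W k i ≤ 1 := fun i => by
    have e1 := hf.sum_inner_products_le (v i) (s := Finset.univ)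
    have e2 := hg.sum_inner_products_le (u i) (s := Finset.univ)
    rw [hv.1 i] at e1
    rw [hu.1 i] at e2
    have e3 : ∑ k, W k i ≤ ∑ k, 2⁻¹ * (‖⟪f k, v i⟫_ℂ‖ ^ 2 + ‖⟪g k, u i⟫_ℂ‖ ^ 2) := by
      refine Finset.sum_le_sum fun k _ => ?_
      rw [hW, norm_inner_symm (f k)]
      nlinarith [sq_nonneg (‖⟪v i, f k⟫_ℂ‖ - ‖⟪g k, u i⟫_ℂ‖)]
    rw [← Finset.mul_sum, Finset.sum_add_distrib] at e3
    linarith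
  calc ∑ k, ∑ i, t k ^ (1 - a) * r i ^ a * W k i
      ≤ ∑ k, ∑ i, ((1 - a) * t k + a * r i) * W k i := by
        refine Finset.sum_le_sum fun k _ => Finset.sum_le_sum fun i _ => ?_
        refine mul_le_mul_of_nonneg_right ?_ (hW0 k i)
        exact Real.geom_mean_le_arith_mean2_weighted (by linarith) ha (ht0 k) (hr0 i) (by ring)
    _ = (1 - a) * ∑ k, t k * ∑ i, W k i + a * ∑ i, r i * ∑ k, W k i := by
        simp only [add_mul, Finset.sum_add_distrib, Finset.mul_sum]
        congr 1
        · exact Finset.sum_congr rfl fun k _ => Finset.sum_congr rfl fun i _ => by ring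
        · rw [Finset.sum_comm]
          exact Finset.sum_congr rfl fun k _ => Finset.sum_congr rfl fun i _ => by ring
    _ ≤ (1 - a) * 1 + a * 1 := by
        have e1 : ∑ k, t k * ∑ i, W k i ≤ 1 := (Finset.sum_le_sum fun k _ =>
          mul_le_of_le_one_right (ht0 k) (h1 k)).trans ht
        have e2 : ∑ i, r i * ∑ k, W k i ≤ 1 := (Finset.sum_le_sum fun i _ =>
          mul_le_of_le_one_right (hr0 i) (h2 i)).trans hr
        exact add_le_add (mul_le_mul_of_nonneg_left e1 (by linarith))
          (mul_le_mul_of_nonneg_left e2 ha)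
    _ = 1 := by ring

theorem IsSVD.hasSum_subtype {A : Op d} {r : ℕ → ℝ≥0} {u v : ℕ → L2 d} (h : IsSVD A r u v)
    (f : L2 d) :
    HasSum (fun n : {n : ℕ // r n ≠ 0} => ((r n : ℝ) : ℂ) • (⟪v n, f⟫_ℂ • u n)) (A f) := by
  refine (Subtype.val_injective.hasSum_iff fun n hn => ?_).mpr (h.hasSum f)
  by_cases h0 : r n = 0
  · simp [h0]
  · exact absurd ⟨⟨n, h0⟩, rfl⟩ hn

/-- Hölder's inequality for Schatten classes. -/
theorem IsSVD.sum_mul_norm_inner_le {A : Op d} {r : ℕ → ℝ≥0} {u v : ℕ → L2 d}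
    (h : IsSVD A r u v) {κ : Type*} [Fintype κ] {f g : κ → L2 d} (hf : Orthonormal ℂ f)
    (hg : Orthonormal ℂ g) {p : ℝ} (hp : 1 ≤ p) {R : ℝ≥0} (hR : 0 < R)
    (hr : (∑' n, (r n : ℝ≥0∞) ^ p) ^ (1 / p) ≤ R) {t : κ → ℝ} (ht0 : ∀ k, 0 ≤ t k)
    (ht : ∑ k, t k ≤ 1) : ∑ k, t k ^ (1 - 1 / p) * ‖⟪g k, A (f k)⟫_ℂ‖ ≤ R := by
  have hp0 : 0 < p := by linarith
  have hlim : Tendsto (fun F : Finset {n : ℕ // r n ≠ 0} => ∑ k, t k ^ (1 - 1 / p) *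
      ‖∑ n ∈ F, ⟪g k, ((r n : ℝ) : ℂ) • (⟪v n, f k⟫_ℂ • u n)⟫_ℂ‖) atTop
      (𝓝 (∑ k, t k ^ (1 - 1 / p) * ‖⟪g k, A (f k)⟫_ℂ‖)) := by
    refine tendsto_finsetSum _ fun k _ => (Tendsto.norm ?_).const_mul _
    exact (h.hasSum_subtype (f k)).mapL (innerSL ℂ (g k))
  refine le_of_tendsto' hlim fun F => ?_
  have hsumr : ∑ n : F, ((r n : ℝ) / R) ^ p ≤ 1 := by
    have e1 : (∑ n : F, (r n : ℝ≥0∞) ^ p) ≤ (R : ℝ≥0∞) ^ p := by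
      refine le_trans ?_ ((ENNReal.rpow_inv_le_iff hp0).mp (by rwa [one_div] at hr))
      rw [Finset.sum_coe_sort F (fun n => (r n : ℝ≥0∞) ^ p)]
      exact (ENNReal.sum_le_tsum F).trans
        (ENNReal.tsum_comp_le_tsum_of_injective Subtype.val_injective _)
    have e2 : (∑ n : F, (r n : ℝ) ^ p) ≤ (R : ℝ) ^ p := by
      simp only [← ENNReal.coe_rpow_of_nonneg _ hp0.le] at e1
      exact_mod_cast e1
    simp only [Real.div_rpow NNReal.zero_le_coe NNReal.zero_le_coe, ← Finset.sum_div]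
    exact (div_le_one (by positivity)).mpr e2
  -- With weights `(rₙ/R)^p`, whose sum is at most `1`, the power `a = 1/p` recovers `rₙ/R`.
  have key := FourierWigner.sum_mul_norm_inner_le (a := 1 / p)
    (h.orthonormal_left.comp (Subtype.val : F → _) Subtype.val_injective)
    (h.orthonormal_right.comp (Subtype.val : F → _) Subtype.val_injective) hf hg
    (by positivity) ((div_le_one hp0).mpr hp) (r := fun n : F => ((r n : ℝ) / R) ^ p)
    (fun n => by positivity) ht0 hsumr ht
  have hRr : (0 : ℝ) < R := hR
  calc ∑ k, t k ^ (1 - 1 / p) *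
      ‖∑ n ∈ F, ⟪g k, ((r n : ℝ) : ℂ) • (⟪v n, f k⟫_ℂ • u n)⟫_ℂ‖
      ≤ ∑ k, t k ^ (1 - 1 / p) * ∑ n : F, (r n : ℝ) * (‖⟪v n, f k⟫_ℂ‖ * ‖⟪g k, u n⟫_ℂ‖) := by
        refine Finset.sum_le_sum fun k _ => mul_le_mul_of_nonneg_left ?_
          (Real.rpow_nonneg (ht0 k) _)
        rw [Finset.sum_coe_sort F
          (fun n => (r n : ℝ) * (‖⟪v n, f k⟫_ℂ‖ * ‖⟪g k, u n⟫_ℂ‖))]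
        refine norm_sum_le_of_le _ fun n _ => ?_
        rw [inner_smul_right, inner_smul_right, norm_mul, norm_mul, Complex.norm_real,
          Real.norm_eq_abs, NNReal.abs_eq]
    _ = R * ∑ k, ∑ n : F, t k ^ (1 - 1 / p) * (((r n : ℝ) / R) ^ p) ^ (1 / p) *
          (‖⟪v n, f k⟫_ℂ‖ * ‖⟪g k, u n⟫_ℂ‖) := by
        rw [Finset.mul_sum]
        refine Finset.sum_congr rfl fun k _ => ?_
        rw [Finset.mul_sum, Finset.mul_sum]
        refine Finset.sum_congr rfl fun n _ => ?_
        rw [← Real.rpow_mul (by positivity), mul_one_div_cancel hp0.ne', Real.rpow_one]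
        field_simp
    _ ≤ R * 1 := mul_le_mul_of_nonneg_left key hRr.le
    _ = R := mul_one _

/-! ### Interpolation -/

theorem norm_inner_bound_of_lt_coe {p : ℝ} {A : Op d} {κ : Type*} [Fintype κ] {f g : κ → L2 d}
    (hf : Orthonormal ℂ f) (hg : Orthonormal ℂ g) (hp : 1 ≤ p) {C : ℝ≥0}
    (hA : schattenNorm p A ≤ C) {t : κ → ℝ} (ht0 : ∀ k, 0 ≤ t k) (ht : ∑ k, t k ≤ 1) :
    ∑ k, t k ^ (1 - 1 / p) * ‖⟪g k, A (f k)⟫_ℂ‖ ≤ C := by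
  refine le_of_forall_gt_imp_ge_of_dense fun R hR => ?_
  have hR0 : 0 < R := C.coe_nonneg.trans_lt hR
  lift R to ℝ≥0 using hR0.le
  obtain ⟨s, e, η, h, hs⟩ := exists_isSVD_lt (hA.trans_lt (ENNReal.coe_lt_coe.mpr hR))
  exact h.sum_mul_norm_inner_le hf hg hp hR0 hs.le ht0 ht

section

variable {ι κ : Type*} [Fintype ι] [Fintype κ]

/-- The phase of `sᵢ^w` is absorbed into `eᵢ`, which leaves the singular values `sᵢ^(Re w)`. -/
theorem exists_isSVD_weyl_cpow {e η : ι → L2 d} (he : Orthonormal ℂ e) (hη : Orthonormal ℂ η)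
    {s : ι → ℝ≥0} (hs : ∀ i, s i ≠ 0) (w : ℂ) :
    ∃ s' e' η', IsSVD (weyl (∑ i, ((s i : ℝ) : ℂ) ^ w • amb (η i) (e i))) s' e' η' ∧
      ∀ p : ℝ, 0 < p → ∑' n, (s' n : ℝ≥0∞) ^ p = ∑ i, ((s i ^ w.re : ℝ≥0) : ℝ≥0∞) ^ p := by
  have hnorm : ∀ i, ‖((s i : ℝ) : ℂ) ^ w‖ = ((s i ^ w.re : ℝ≥0) : ℝ) := fun i => by
    rw [Complex.norm_cpow_eq_rpow_re_of_pos (by exact_mod_cast pos_iff_ne_zero.mpr (hs i)),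
      NNReal.coe_rpow]
  have hne : ∀ i, ((s i ^ w.re : ℝ≥0) : ℝ) ≠ 0 := fun i => by
    exact_mod_cast (NNReal.rpow_pos (pos_iff_ne_zero.mpr (hs i))).ne'
  let c : ι → ℂ := fun i => ((s i : ℝ) : ℂ) ^ w / (((s i ^ w.re : ℝ≥0) : ℝ) : ℂ)
  have hc : ∀ i, ‖c i‖ = 1 := fun i => by
    simp only [c, norm_div, hnorm, Complex.norm_real, Real.norm_eq_abs, NNReal.abs_eq]
    exact div_self (hne i)
  have he' : Orthonormal ℂ fun i => c i • e i := by
    refine ⟨fun i => by rw [norm_smul, hc, he.1 i, one_mul], fun i k hik => ?_⟩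
    beta_reduce
    rw [inner_smul_left, inner_smul_right, he.2 hik, mul_zero, mul_zero]
  obtain ⟨s', e', η', h, hsum⟩ := exists_isSVD_of_countable
    (T := weyl (∑ i, ((s i : ℝ) : ℂ) ^ w • amb (η i) (e i))) (s := fun i => s i ^ w.re)
    (e := fun i => c i • e i) (η := η) (Summable.of_finite) he' hη fun f => by
      have h1 : weyl (∑ i, ((s i : ℝ) : ℂ) ^ w • amb (η i) (e i)) f =
          ∑ i, (((s i ^ w.re : ℝ≥0) : ℝ) : ℂ) • (⟪η i, f⟫_ℂ • (c i • e i)) := by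
        rw [← weylL_apply, map_sum, sum_apply]
        refine Finset.sum_congr rfl fun i _ => ?_
        have h0 : (((s i ^ w.re : ℝ≥0) : ℝ) : ℂ) ≠ 0 := by exact_mod_cast hne i
        rw [weylL_apply, weyl_smul, smul_apply, weyl_amb_apply]
        simp only [smul_smul, c]
        congr 1
        field_simp
      rw [h1]
      exact hasSum_fintype _
  exact ⟨s', e', η', h, fun p hp => by rw [hsum p hp, tsum_fintype]⟩

/-- The form `tr(𝔗_m(T_w) S_w)` for `T_w = ∑ sᵢ^w eᵢ ⊗ ηᵢ` and `S_w = ∑ tₖ^(1-w) fₖ ⊗ gₖ`. -/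
def interpForm (m : LInf d) (s : ι → ℝ≥0) (e η : ι → L2 d) (t : κ → ℝ≥0) (f g : κ → L2 d)
    (w : ℂ) : ℂ :=
  ∑ i, ∑ k, ((s i : ℝ) : ℂ) ^ w * ((t k : ℝ) : ℂ) ^ (1 - w) *
    ⟪amb (f k) (g k), mulL m (amb (η i) (e i))⟫_ℂ

/-- On this line `T_w` lies in the unit ball of `𝓢^p`, and the coefficients of `S_w` have modulus
`tₖ^(1 - 1/p)`, so Hölder applies. As `T_w` has finite rank, `Φ` acts on it as `𝔗_m`. -/
theorem norm_interpForm_le_of_re_eq {p : ℝ} (hp : 1 ≤ p) {m : LInf d} {Φ : Op d → Op d} {C : ℝ≥0}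
    (hΦ : IsBoundedExtension p p m Φ C) {e η : ι → L2 d} {f g : κ → L2 d}
    (he : Orthonormal ℂ e) (hη : Orthonormal ℂ η) (hf : Orthonormal ℂ f) (hg : Orthonormal ℂ g)
    {s : ι → ℝ≥0} {t : κ → ℝ≥0} (hs0 : ∀ i, s i ≠ 0) (ht0 : ∀ k, t k ≠ 0) (hs : ∑ i, s i ≤ 1)
    (ht : ∑ k, t k ≤ 1) {w : ℂ} (hw : w.re = 1 / p) : ‖interpForm m s e η t f g w‖ ≤ C := by
  have hp0 : 0 < p := by linarith
  obtain ⟨s', e', η', h, hsum⟩ := exists_isSVD_weyl_cpow he hη hs0 w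
  set u := ∑ i, ((s i : ℝ) : ℂ) ^ w • amb (η i) (e i) with hu
  have hfin : ∀ r : ℝ, 1 ≤ r → weyl u ∈ schattenClass d r := fun r hr => by
    refine (h.schattenNorm_le r).trans_lt ?_
    rw [hsum r (by linarith)]
    refine ENNReal.rpow_lt_top_of_nonneg (by positivity) (ENNReal.sum_lt_top.mpr fun n _ => ?_).ne
    exact ENNReal.rpow_lt_top_of_nonneg (by linarith) ENNReal.coe_ne_top
  have hle : schattenNorm p (weyl u) ≤ 1 := by
    refine (h.schattenNorm_le p).trans ?_
    rw [hsum p hp0]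
    refine ENNReal.rpow_le_one ?_ (by positivity)
    have h1 : ∀ i, ((s i ^ w.re : ℝ≥0) : ℝ≥0∞) ^ p = s i := fun i => by
      rw [← ENNReal.coe_rpow_of_nonneg _ hp0.le, ← NNReal.rpow_mul, hw, one_div_mul_cancel hp0.ne',
        NNReal.rpow_one]
    simp only [h1]
    exact_mod_cast hs
  have hA := hΦ.bound _ (hfin p hp)
  rw [(isMultiplierImage_weyl_iff m (hfin 1 le_rfl) _).mp
    (hΦ.extends_multiplier _ (hfin 1 le_rfl))] at hA
  have hA1 : schattenNorm p (weyl (mulL m u)) ≤ C :=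
    hA.trans ((mul_le_mul_right hle _).trans_eq (mul_one _))
  have key := norm_inner_bound_of_lt_coe hf hg hp hA1 (t := fun k => t k)
    (fun k => NNReal.zero_le_coe) (by exact_mod_cast ht)
  have hform : interpForm m s e η t f g w =
      ∑ k, ((t k : ℝ) : ℂ) ^ (1 - w) * ⟪g k, weyl (mulL m u) (f k)⟫_ℂ := by
    rw [interpForm, Finset.sum_comm]
    refine Finset.sum_congr rfl fun k _ => ?_
    rw [inner_weyl, hu, map_sum, inner_sum, Finset.mul_sum]
    refine Finset.sum_congr rfl fun i _ => ?_
    rw [map_smul, inner_smul_right]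
    ring
  rw [hform]
  refine (norm_sum_le_of_le _ fun k _ => ?_).trans key
  rw [norm_mul, Complex.norm_cpow_eq_rpow_re_of_pos
    (by exact_mod_cast pos_iff_ne_zero.mpr (ht0 k)), Complex.sub_re, Complex.one_re, hw]

theorem interpForm_parity (m : LInf d) (s : ι → ℝ≥0) (e η : ι → L2 d) (t : κ → ℝ≥0)
    (f g : κ → L2 d) (w : ℂ) :
    interpForm m s e η t f g w = interpForm m t (parity d ∘ f) (parity d ∘ g) s (parity d ∘ e)
      (parity d ∘ η) (1 - w) := by
  rw [interpForm, interpForm, Finset.sum_comm]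
  refine Finset.sum_congr rfl fun k _ => Finset.sum_congr rfl fun i _ => ?_
  rw [inner_mulL_parity, sub_sub_cancel, mul_comm (((s i : ℝ) : ℂ) ^ w)]
  rfl

theorem differentiable_interpForm (m : LInf d) {s : ι → ℝ≥0} (e η : ι → L2 d) {t : κ → ℝ≥0}
    (f g : κ → L2 d) (hs0 : ∀ i, s i ≠ 0) (ht0 : ∀ k, t k ≠ 0) :
    Differentiable ℂ (interpForm m s e η t f g) := by
  intro w
  unfold interpForm
  have h1 : ∀ i, DifferentiableAt ℂ (fun w : ℂ => ((s i : ℝ) : ℂ) ^ w) w := fun i =>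
    differentiableAt_id.const_cpow (Or.inl (by exact_mod_cast hs0 i))
  have h2 : ∀ k, DifferentiableAt ℂ (fun w : ℂ => ((t k : ℝ) : ℂ) ^ (1 - w)) w := fun k =>
    (differentiableAt_id.const_sub 1).const_cpow (Or.inl (by exact_mod_cast ht0 k))
  exact DifferentiableAt.fun_sum fun i _ => DifferentiableAt.fun_sum fun k _ =>
    ((h1 i).mul (h2 k)).mul_const _

theorem norm_interpForm_le_sum (m : LInf d) {s : ι → ℝ≥0} (e η : ι → L2 d) {t : κ → ℝ≥0}
    (f g : κ → L2 d) (hs0 : ∀ i, s i ≠ 0) (ht0 : ∀ k, t k ≠ 0) (hs : ∑ i, s i ≤ 1)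
    (ht : ∑ k, t k ≤ 1) {w : ℂ} (hw0 : 0 ≤ w.re) (hw1 : w.re ≤ 1) :
    ‖interpForm m s e η t f g w‖ ≤
      ∑ i, ∑ k, ‖⟪amb (f k) (g k), mulL m (amb (η i) (e i))⟫_ℂ‖ := by
  refine norm_sum_le_of_le _ fun i _ => norm_sum_le_of_le _ fun k _ => ?_
  have hs1 : s i ≤ 1 := (Finset.single_le_sum (fun _ _ => zero_le) (Finset.mem_univ i)).trans hs
  have ht1 : t k ≤ 1 := (Finset.single_le_sum (fun _ _ => zero_le) (Finset.mem_univ k)).trans ht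
  rw [norm_mul, norm_mul, Complex.norm_cpow_eq_rpow_re_of_pos
    (by exact_mod_cast pos_iff_ne_zero.mpr (hs0 i)), Complex.norm_cpow_eq_rpow_re_of_pos
    (by exact_mod_cast pos_iff_ne_zero.mpr (ht0 k))]
  refine mul_le_of_le_one_left (norm_nonneg _) (mul_le_one₀ ?_ (by positivity) ?_)
  · exact Real.rpow_le_one NNReal.zero_le_coe (by exact_mod_cast hs1) hw0
  · exact Real.rpow_le_one NNReal.zero_le_coe (by exact_mod_cast ht1) (by simpa using hw1)

theorem norm_interpForm_le {p q : ℝ} (hp : 1 ≤ p) (hpq : p < q) (hq : q ≤ 2) {m : LInf d}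
    {Φ : Op d → Op d} {C : ℝ≥0} (hΦ : IsBoundedExtension p p m Φ C) {e η : ι → L2 d}
    {f g : κ → L2 d} (he : Orthonormal ℂ e) (hη : Orthonormal ℂ η) (hf : Orthonormal ℂ f)
    (hg : Orthonormal ℂ g) {s : ι → ℝ≥0} {t : κ → ℝ≥0} (hs0 : ∀ i, s i ≠ 0) (ht0 : ∀ k, t k ≠ 0)
    (hs : ∑ i, s i ≤ 1) (ht : ∑ k, t k ≤ 1) :
    ‖interpForm m s e η t f g ((1 / q : ℝ) : ℂ)‖ ≤ C := by
  have hp0 : 0 < p := by linarith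
  have hq0 : 0 < q := by linarith
  have hp1 : 1 / p ≤ 1 := (div_le_one hp0).mpr hp
  have hqp : 1 / q < 1 / p := one_div_lt_one_div_of_lt hp0 hpq
  have hq2 : 1 / 2 ≤ 1 / q := one_div_le_one_div_of_le hq0 hq
  -- The form is bounded on the strip, so both growth parameters can be `0`.
  refine PhragmenLindelof.vertical_strip (a := 1 - 1 / p) (b := 1 / p)
    (differentiable_interpForm m e η f g hs0 ht0).diffContOnCl ⟨0, ?_, 0, ?_⟩ ?_ ?_ ?_ ?_
  · exact div_pos Real.pi_pos (by linarith)
  · refine Asymptotics.IsBigO.of_bound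
      (∑ i, ∑ k, ‖⟪amb (f k) (g k), mulL m (amb (η i) (e i))⟫_ℂ‖) ?_
    refine Eventually.filter_mono inf_le_right (eventually_principal.mpr fun w hw => ?_)
    simp only [zero_mul, Real.exp_zero, norm_one, mul_one]
    exact norm_interpForm_le_sum m e η f g hs0 ht0 hs ht (by linarith [hw.1]) (by linarith [hw.2])
  · intro w hw
    -- On the left edge `Re w = 1 - 1/p`, parity swaps the two families and moves `w` to `1 - w` on
    -- the right edge.
    rw [interpForm_parity]
    exact norm_interpForm_le_of_re_eq hp hΦ (hf.comp_linearIsometry _) (hg.comp_linearIsometry _)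
      (he.comp_linearIsometry _) (hη.comp_linearIsometry _) ht0 hs0 ht hs (by simp [hw])
  · intro w hw
    exact norm_interpForm_le_of_re_eq hp hΦ he hη hf hg hs0 ht0 hs ht hw
  · rw [Complex.ofReal_re]; linarith
  · rw [Complex.ofReal_re]; exact hqp.le

end

/-! ### Duality and passage to `𝓢^q`. -/

/-- The weights `rₖ^q / R` are extremal in Hölder's inequality: the pairing attains the `ℓ^q` norm
of `r`. -/
theorem sum_div_rpow_mul {κ : Type*} [Fintype κ] {q : ℝ} (hq : 0 < q) {r : κ → ℝ}
    (hr : ∀ k, 0 < r k) {R : ℝ} (hR : 0 < R) (hRr : ∑ k, r k ^ q = R) :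
    ∑ k, (r k ^ q / R) ^ (1 - 1 / q) * r k = R ^ (1 / q) := by
  have h1 : ∀ k, (r k ^ q / R) ^ (1 - 1 / q) * r k = r k ^ q * (R ^ (1 / q) / R) := fun k => by
    have hk := hr k
    rw [Real.div_rpow (by positivity) hR.le, Real.rpow_sub (by positivity), Real.rpow_sub hR,
      Real.rpow_one, Real.rpow_one, ← Real.rpow_mul hk.le, mul_one_div_cancel hq.ne',
      Real.rpow_one]
    field_simp
  simp only [h1]
  rw [← Finset.sum_mul, hRr]
  field_simp

theorem IsSVD.hasSum_symbolTerm_subtype {u : L2Phase d} {s : ℕ → ℝ≥0} {e η : ℕ → L2 d}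
    (h : IsSVD (weyl u) s e η) :
    HasSum (fun n : {n : ℕ // s n ≠ 0} => symbolTerm s e η n) u := by
  refine (Subtype.val_injective.hasSum_iff fun n hn => ?_).mpr h.hasSum_sq.1
  by_cases h0 : s n = 0
  · simp [symbolTerm, h0]
  · exact absurd ⟨⟨n, h0⟩, rfl⟩ hn

/-- Duality: a bound for the interpolation form bounds finite sums of singular values. -/
theorem sum_rpow_le_of_norm_interpForm_le {q : ℝ} (hq : 1 ≤ q) {m : LInf d} {C V : ℝ≥0}
    (hV0 : 0 < V) {u : L2Phase d} {s r : ℕ → ℝ≥0} {e η x y : ℕ → L2 d}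
    (h : IsSVD (weyl u) s e η) (hA : IsSVD (weyl (mulL m u)) r x y)
    (hV : (∑' n, (s n : ℝ≥0∞) ^ q) ^ (1 / q) ≤ V) (F : Finset {n : ℕ // r n ≠ 0})
    (hbound : ∀ (E : Finset {n : ℕ // s n ≠ 0}) (σ : E → ℝ≥0) (t : F → ℝ≥0),
      (∀ i, σ i ≠ 0) → (∀ k, t k ≠ 0) → ∑ i, σ i ≤ 1 → ∑ k, t k ≤ 1 →
        ‖interpForm m σ (fun i : E => e i) (fun i : E => η i) t (fun k : F => y k)
          (fun k : F => x k) ((1 / q : ℝ) : ℂ)‖ ≤ C) :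
    ∑ k : F, r k ^ q ≤ (C * V) ^ q := by
  have hq0 : 0 < q := by linarith
  set R : ℝ≥0 := ∑ k : F, r k ^ q with hRdef
  rcases eq_or_ne R 0 with hR | hR
  · rw [hR]; exact zero_le
  have hR0 : (0 : ℝ) < R := by exact_mod_cast pos_iff_ne_zero.mpr hR
  have hVr : (0 : ℝ) < V := hV0
  have hrk : ∀ k : F, (0 : ℝ) < r k := fun k => by exact_mod_cast pos_iff_ne_zero.mpr k.1.2
  let t : F → ℝ≥0 := fun k => r k ^ q / R
  have ht0 : ∀ k, t k ≠ 0 := fun k =>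
    div_ne_zero (NNReal.rpow_pos (pos_iff_ne_zero.mpr k.1.2)).ne' hR
  have ht : ∑ k, t k ≤ 1 := by
    simp only [t, ← Finset.sum_div]
    exact (div_self hR).le
  have hE : ∀ E : Finset {n : ℕ // s n ≠ 0},
      ‖(V : ℂ)⁻¹ * ∑ k : F, (((t k : ℝ) ^ (1 - 1 / q) : ℝ) : ℂ) *
        ∑ i ∈ E, ⟪amb (y k) (x k), mulL m (symbolTerm s e η i)⟫_ℂ‖ ≤ C := by
    intro E
    -- Chosen so that `σᵢ^(1/q) = sᵢ/V`: at `w = 1/q` the form sees the truncated symbol of `u`,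
    -- divided by `V`.
    let σ : E → ℝ≥0 := fun i => (s i / V) ^ q
    have hσ0 : ∀ i, σ i ≠ 0 := fun i =>
      (NNReal.rpow_pos (div_pos (pos_iff_ne_zero.mpr i.1.2) hV0)).ne'
    have hσ : ∑ i, σ i ≤ 1 := by
      have e1 : (∑ n : E, (s n : ℝ≥0∞) ^ q) ≤ (V : ℝ≥0∞) ^ q := by
        refine le_trans ?_ ((ENNReal.rpow_inv_le_iff hq0).mp (by rwa [one_div] at hV))
        rw [Finset.sum_coe_sort E (fun n => (s n : ℝ≥0∞) ^ q)]
        exact (ENNReal.sum_le_tsum E).trans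
          (ENNReal.tsum_comp_le_tsum_of_injective Subtype.val_injective _)
      simp only [← ENNReal.coe_rpow_of_nonneg _ hq0.le] at e1
      simp only [σ, NNReal.div_rpow, ← Finset.sum_div]
      exact (div_le_one (NNReal.rpow_pos hV0)).mpr (by exact_mod_cast e1)
    refine le_trans (le_of_eq ?_) (hbound E σ t hσ0 ht0 hσ ht)
    congr 1
    rw [interpForm, Finset.sum_comm, Finset.mul_sum]
    refine Finset.sum_congr rfl fun k _ => ?_
    rw [Finset.mul_sum, Finset.mul_sum, ← Finset.sum_coe_sort E]
    refine Finset.sum_congr rfl fun i _ => ?_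
    have e2 : ((σ i : ℝ) : ℂ) ^ ((1 / q : ℝ) : ℂ) = ((s i : ℝ) : ℂ) / (V : ℂ) := by
      rw [← Complex.ofReal_cpow NNReal.zero_le_coe]
      simp only [σ, NNReal.coe_rpow]
      rw [← Real.rpow_mul NNReal.zero_le_coe, mul_one_div_cancel hq0.ne', Real.rpow_one]
      push_cast
      rfl
    have e3 : ((t k : ℝ) : ℂ) ^ (1 - ((1 / q : ℝ) : ℂ)) = (((t k : ℝ) ^ (1 - 1 / q) : ℝ) : ℂ) := by
      rw [Complex.ofReal_cpow NNReal.zero_le_coe]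
      push_cast
      rfl
    rw [e2, e3, symbolTerm, map_smul, inner_smul_right]
    field_simp
  have hlim : Tendsto (fun E : Finset {n : ℕ // s n ≠ 0} =>
      ‖(V : ℂ)⁻¹ * ∑ k : F, (((t k : ℝ) ^ (1 - 1 / q) : ℝ) : ℂ) *
        ∑ i ∈ E, ⟪amb (y k) (x k), mulL m (symbolTerm s e η i)⟫_ℂ‖) atTop
      (𝓝 ‖(V : ℂ)⁻¹ * ∑ k : F, (((t k : ℝ) ^ (1 - 1 / q) : ℝ) : ℂ) *
        ⟪amb (y k) (x k), mulL m u⟫_ℂ‖) := by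
    refine (Tendsto.const_mul _ (tendsto_finsetSum _ fun k _ => Tendsto.const_mul _ ?_)).norm
    exact (h.hasSum_symbolTerm_subtype.mapL (mulL m)).mapL (innerSL ℂ (amb (y k) (x k)))
  have hle := le_of_tendsto' hlim hE
  -- Pairing against the singular vectors of `weyl (mulL m u)` gives `⟨xₖ, 𝔗_m(T) yₖ⟩ = rₖ`, so the
  -- extremal weights produce `R^(1/q)`.
  have hval : (V : ℂ)⁻¹ * ∑ k : F, (((t k : ℝ) ^ (1 - 1 / q) : ℝ) : ℂ) *
      ⟪amb (y k) (x k), mulL m u⟫_ℂ = (((V : ℝ)⁻¹ * (R : ℝ) ^ (1 / q) : ℝ) : ℂ) := by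
    have e1 : (∑ k : F, (r k : ℝ) ^ q) = R := by
      rw [hRdef]
      push_cast
      rfl
    rw [← sum_div_rpow_mul hq0 hrk hR0 e1]
    push_cast
    congr 1
    refine Finset.sum_congr rfl fun k _ => ?_
    rw [← inner_weyl, hA.apply_right k.1.2, inner_smul_right, inner_self_eq_norm_sq_to_K,
      hA.norm_left k.1.2]
    simp [t]
  rw [hval, Complex.norm_real, Real.norm_of_nonneg (by positivity), inv_mul_le_iff₀ hVr,
    mul_comm (V : ℝ)] at hle
  have hle' : R ^ (1 / q) ≤ C * V := by exact_mod_cast hle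
  rwa [one_div, NNReal.rpow_inv_le_iff hq0] at hle'

/-- `Φ` is controlled only on `𝓢^p`, so the extension to the larger class `𝓢^q` is the one given by
symbols. Its norm is the supremum over finite sets of nonzero singular values. -/
theorem isBoundedExtension_of_lt {p q : ℝ} (hp : 1 ≤ p) (hpq : p < q) (hq : q ≤ 2) {m : LInf d}
    {Φ : Op d → Op d} {C : ℝ≥0} (hΦ : IsBoundedExtension p p m Φ C) :
    IsBoundedExtension q q m (multiplierExt m) C := by
  have hq0 : 0 < q := by linarith
  refine isBoundedExtension_multiplierExt (by linarith) hq fun u s e η h V hV0 hV => ?_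
  obtain ⟨r, x, y, hA⟩ := exists_isSVD_weyl (mulL m u)
  refine (hA.schattenNorm_le q).trans ?_
  rw [one_div, ENNReal.rpow_inv_le_iff hq0,
    ← Subtype.val_injective.tsum_eq (g := (Subtype.val : {n : ℕ // r n ≠ 0} → ℕ)) fun n hn =>
      ⟨⟨n, fun hc => hn (by simp [hc, hq0])⟩, rfl⟩, ENNReal.tsum_eq_iSup_sum]
  refine iSup_le fun F => ?_
  have key := sum_rpow_le_of_norm_interpForm_le (by linarith) hV0 h hA hV F
    fun E σ t hσ0 ht0 hσ ht => norm_interpForm_le hp hpq hq hΦ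
      (h.orthonormal_left.comp (Subtype.val : E → _) Subtype.val_injective)
      (h.orthonormal_right.comp (Subtype.val : E → _) Subtype.val_injective)
      (hA.orthonormal_right.comp (Subtype.val : F → _) Subtype.val_injective)
      (hA.orthonormal_left.comp (Subtype.val : F → _) Subtype.val_injective) hσ0 ht0 hσ ht
  rw [← Finset.sum_coe_sort F]
  simp only [← ENNReal.coe_mul, ← ENNReal.coe_rpow_of_nonneg _ hq0.le]
  exact_mod_cast key

/-- The multiplier classes `𝔐_p` increase and the multiplier norms decrease for `1 ≤ p ≤ 2`. -/
theorem multipliers_mono {a b : ℝ} (ha : 1 ≤ a) (hab : a ≤ b) (hb : b ≤ 2) :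
    multipliers d a ⊆ multipliers d b ∧
      ∀ m ∈ multipliers d a, multiplierNorm b m ≤ multiplierNorm a m := by
  rcases hab.eq_or_lt with rfl | hlt
  · exact ⟨subset_rfl, fun _ _ => le_rfl⟩
  · refine ⟨?_, ?_⟩
    · rintro m ⟨Φ, C, hΦ⟩
      exact ⟨_, C, isBoundedExtension_of_lt ha hlt hb hΦ⟩
    · rintro m ⟨Φ, C, hΦ⟩
      refine le_csInf ⟨C, Φ, hΦ⟩ ?_
      rintro C' ⟨Φ', hΦ'⟩
      exact csInf_le' ⟨_, isBoundedExtension_of_lt ha hlt hb hΦ'⟩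

end FourierWigner

end

theorem mainTheorem7 (d : ℕ) (p q : ℝ) (hp : 1 ≤ p) (hpq : p < q) (hq : q ≤ 2) :
    (FourierWigner.multipliers d 1 ⊆ FourierWigner.multipliers d p ∧
      FourierWigner.multipliers d p ⊆ FourierWigner.multipliers d q ∧
      FourierWigner.multipliers d q ⊆ FourierWigner.multipliers d 2 ∧
      FourierWigner.multipliers d 2 = Set.univ ∧
      ∀ m : FourierWigner.LInf d, (FourierWigner.multiplierNorm 2 m : ℝ) = ‖m‖) ∧
    (∀ m ∈ FourierWigner.multipliers d q,
      FourierWigner.multiplierNorm 2 m ≤ FourierWigner.multiplierNorm q m) ∧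
    (∀ m ∈ FourierWigner.multipliers d p,
      FourierWigner.multiplierNorm q m ≤ FourierWigner.multiplierNorm p m) ∧
    (∀ m ∈ FourierWigner.multipliers d 1,
      FourierWigner.multiplierNorm p m ≤ FourierWigner.multiplierNorm 1 m) := by
  obtain ⟨h1, h1'⟩ := FourierWigner.multipliers_mono (d := d) le_rfl hp (by linarith)
  obtain ⟨h2, h2'⟩ := FourierWigner.multipliers_mono (d := d) hp hpq.le hq
  obtain ⟨h3, h3'⟩ := FourierWigner.multipliers_mono (d := d) (by linarith) hq le_rfl
  exact ⟨⟨h1, h2, h3, FourierWigner.multipliers_two, FourierWigner.multiplierNorm_two⟩,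
    h3', h2', h1'⟩
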